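/- Let $S_\infty$ be the group of permutations of $\{1,2,3,\dots\}$ that fix all but finitely many elements. Let $t_{i,j}\in S_\infty$ be the transposition of $i$ and $j$, and let $s_i=t_{i,i+1}$. Let $\ell(w)$ be the Coxeter length of $w$ (the least number of factors in an expression of $w$ as a product of simple transpositions $s_i$). Let $<$ be the strict Bruhat order, i.e. the transitive closure of the covering relations $wt_{i,j}\lessdot w$ for $\ell(wt_{i,j})=\ell(w)-1$. The Schubert polynomials $\mathfrak S_w\in\mathbb Z[x_1,x_2,\dots]$ $(w\in S_\infty)$ are defined recursively by $\mathfrak S_{w_0^{(n)}}=x_1^{n-1}x_2^{n-2}\cdots x_n^0$, where $w_0^{(n)}=n(n-1)\cdots 1$ is the long element of $S_n\subset S_\infty$, $n\ge 1$, and by $$\mathfrak S_{ws_i}=N_i\,\mathfrak S_w\quad\text{whenever } ws_i<w,\qquad N_i(f)=\frac{f-s_i\cdot f}{x_i-x_{i+1}},$$ where $s_i$ acts on polynomials by swapping $x_i$ and $x_{i+1}$. The Schubert structure coefficients $c_{u,v}^w\in\mathbb Z$ are defined by $\mathfrak S_u\,\mathfrak S_v=\sum_w c_{u,v}^w\,\mathfrak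 S_w$, a finite sum. **Theorem 1.1.** These definitions are meaningful: the recursion assigns exactly one polynomial to each $w\in S_\infty$, and the polynomials $\mathfrak S_w$, $w\in S_\infty$, form a basis of the free $\mathbb Z$-module $\mathbb Z[x_1,x_2,\dots]$. Moreover, for all $u,v,w\in S_\infty$, each of the following sums over positive integers $i,j,k$ has only finitely many nonzero terms, and $$\sum_{s_iu<u} i\,c_{s_iu,v}^{w}+\sum_{s_jv<v} j\,c_{u,s_jv}^{w}=\sum_{s_kw>w} k\,c_{u,v}^{s_kw}.$$ -/

import Mathlib

noncomputable section

/-- The infinite symmetric group: the permutations of `{1, 2, 3, …}` that fix all but finitely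
many elements. -/
def SInf : Subgroup (Equiv.Perm ℕ+) where
  carrier := {w | {k | w k ≠ k}.Finite}
  one_mem' := by simp
  mul_mem' := by
    intro a b ha hb
    refine (ha.union hb).subset ?_
    intro k hk
    by_contra h
    simp only [Set.mem_union, Set.mem_ofPred_eq, not_or, not_not] at h
    exact hk (by rw [Equiv.Perm.mul_apply, h.2, h.1])
  inv_mem' := by
    intro a ha
    refine Set.Finite.subset ha ?_
    intro k hk h
    exact hk (by rw [Equiv.Perm.inv_eq_iff_eq, h])

/-- The transposition `t_{i,j}` (the identity if `i = j`). -/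
def transp (i j : ℕ+) : SInf :=
  ⟨Equiv.swap i j, (Set.toFinite {i, j}).subset (by
    intro k hk
    by_contra h
    simp only [Set.mem_insert_iff, Set.mem_singleton_iff, not_or] at h
    exact hk (Equiv.swap_apply_of_ne_of_ne h.1 h.2))⟩

/-- The simple transposition `s_i`. -/
def simpleRefl (i : ℕ+) : SInf := transp i (i + 1)

/-- The Coxeter length: the least number of factors in an expression of `w` as a product of simple
transpositions. -/
def coxLength (w : SInf) : ℕ :=
  sInf {n | ∃ l : List ℕ+, l.length = n ∧ (l.map simpleRefl).prod = w}

/-- The covering relation `a ⋖ b` of Bruhat order: `a = b t_{i,j}` and `ℓ(a) = ℓ(b) - 1`. -/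
def BruhatCovBy (a b : SInf) : Prop :=
  ∃ i j : ℕ+, a = b * transp i j ∧ coxLength a + 1 = coxLength b

/-- The strict Bruhat order `a < b`. -/
def BruhatLT (a b : SInf) : Prop := Relation.TransGen BruhatCovBy a b

lemma longElement_involutive (n : ℕ+) :
    Function.Involutive (fun k : ℕ+ => if k ≤ n then n + 1 - k else k) := by
  intro k
  by_cases h : k ≤ n
  · have h1 : k < n + 1 := PNat.lt_add_one_iff.2 h
    have h2 : ((n + 1 - k : ℕ+) : ℕ) = n + 1 - k := by
      rw [PNat.sub_coe, if_pos h1]; simp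
    have hk := k.pos
    have hkn : (k : ℕ) ≤ n := h
    have h3 : n + 1 - k ≤ n := by
      rw [← PNat.coe_le_coe, h2]; omega
    have h4 : n + 1 - k < n + 1 := PNat.lt_add_one_iff.2 h3
    simp only [h, h3, if_true]
    apply PNat.eq
    rw [PNat.sub_coe, if_pos h4, h2]
    simp only [PNat.add_coe, PNat.one_coe]
    omega
  · simp [h]

/-- The long element `n (n-1) ⋯ 1` of `S_n`, as an element of `S_∞`. -/
def longElement (n : ℕ+) : SInf :=
  ⟨(longElement_involutive n).toPerm, (Set.finite_Iic n).subset (by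
    intro k hk
    by_contra h
    exact hk (if_neg h))⟩

lemma dividedDiff_dvd (i : ℕ+) (f : MvPolynomial ℕ+ ℤ) :
    (MvPolynomial.X i - MvPolynomial.X (i + 1) : MvPolynomial ℕ+ ℤ) ∣
      f - MvPolynomial.rename (Equiv.swap i (i + 1)) f := by
  set I : Ideal (MvPolynomial ℕ+ ℤ) :=
    Ideal.span {MvPolynomial.X i - MvPolynomial.X (i + 1)} with hI
  rw [← Ideal.mem_span_singleton, ← hI, ← Ideal.Quotient.eq]
  have hx : Ideal.Quotient.mk I (MvPolynomial.X i) =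
      Ideal.Quotient.mk I (MvPolynomial.X (i + 1)) := by
    rw [Ideal.Quotient.eq]
    exact Ideal.subset_span rfl
  have key : (Ideal.Quotient.mk I) = (Ideal.Quotient.mk I).comp
      (MvPolynomial.rename (R := ℤ) (Equiv.swap i (i + 1))).toRingHom := by
    apply MvPolynomial.ringHom_ext
    · intro r
      simp
    · intro k
      by_cases h1 : k = i
      · subst h1; simp [hx]
      · by_cases h2 : k = i + 1
        · subst h2; simp [hx]
        · simp [Equiv.swap_apply_of_ne_of_ne h1 h2]
  exact congrArg (fun φ => φ f) key

/-- The Newton divided difference `N_i f = (f - s_i f) / (x_i - x_{i+1})` in `ℤ[x₁, x₂, …]`. -/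
def dividedDiff (i : ℕ+) (f : MvPolynomial ℕ+ ℤ) : MvPolynomial ℕ+ ℤ :=
  Classical.choose (dividedDiff_dvd i f)

lemma dividedDiff_spec (i : ℕ+) (f : MvPolynomial ℕ+ ℤ) :
    (MvPolynomial.X i - MvPolynomial.X (i + 1)) * dividedDiff i f =
      f - MvPolynomial.rename (Equiv.swap i (i + 1)) f :=
  (Classical.choose_spec (dividedDiff_dvd i f)).symm

/-- `IsSchubert w f`: the recursive definition of Schubert polynomials assigns `f` to `w`. It starts
from `x₁^(n-1) x₂^(n-2) ⋯ x_n^0` for the long element of `S_n`, for any `n`, and assigns `N_i f` to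
`w s_i` whenever it assigns `f` to `w` and `w s_i < w`. -/
inductive IsSchubert : SInf → MvPolynomial ℕ+ ℤ → Prop
  | long (n : ℕ+) : IsSchubert (longElement n)
      (∏ k ∈ Finset.Icc 1 n, MvPolynomial.X k ^ ((n : ℕ) - (k : ℕ)))
  | step (w : SInf) (f : MvPolynomial ℕ+ ℤ) (i : ℕ+) (hf : IsSchubert w f)
      (hi : BruhatLT (w * simpleRefl i) w) : IsSchubert (w * simpleRefl i) (dividedDiff i f)

/-- The Schubert polynomial of `w`: the polynomial assigned to `w` by the recursive definition. -/
def schubert (w : SInf) : MvPolynomial ℕ+ ℤ := Classical.epsilon (IsSchubert w)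

/-- The Schubert structure coefficients: `schubertCoeff u v w` is the coefficient `c_{u,v}^w` in the
expansion `𝔖_u 𝔖_v = ∑_w c_{u,v}^w 𝔖_w`. -/
def schubertCoeff (u v : SInf) : SInf →₀ ℤ :=
  Classical.epsilon fun c : SInf →₀ ℤ =>
    (c.sum fun w a => a • schubert w) = schubert u * schubert v

end

/-! Let ∇ = ∑ ∂/∂x_i. It kills x_i - x_{i+1} and commutes with permuting variables, hence with every
N_i. On a staircase monomial, ∇ gives ∑ k 𝔖_{s_k w} over the left descents k of the long element.
Applying N_i carries this formula down the recursion to every w (`IsSchubert.nabla_eq`). The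
identity compares the coefficients of 𝔖_w on the two sides of the Leibniz rule for ∇(𝔖_u 𝔖_v).

Well-definedness: Coxeter length is the number of inversions, so going down in the recursion means
removing a descent. Inside a fixed S_n, two routes to w agree by a diamond argument based on the
commutation and braid relations of the N_i (`schubertChain_diamond`). The result does not depend on
n, because the staircase of n + 1 leads to the staircase of n (`SchubertChain.succ`).

Basis: N_i sends 𝔖_w to 𝔖_{w s_i} at a descent and to 0 otherwise, and a polynomial killed by every
N_i is constant. A linear relation is therefore shortened by each N_i, which gives independence by
induction on length. For spanning, induct on degree: the expansions of all N_i f glue to one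
candidate expansion of f (`exists_stepCoeff_eq`), which differs from f by a constant. -/

/-! ### Descents, inversions and Coxeter length -/

/-- `w` has a descent at position `i`. -/
def IsDescent (w : SInf) (i : ℕ+) : Prop := w.1 (i + 1) < w.1 i

instance (w : SInf) (i : ℕ+) : Decidable (IsDescent w i) :=
  inferInstanceAs (Decidable (w.1 (i + 1) < w.1 i))

lemma mul_simpleRefl_apply (w : SInf) (i k : ℕ+) :
    (w * simpleRefl i).1 k = w.1 (Equiv.swap i (i + 1) k) := rfl

@[simp] lemma simpleRefl_mul_self (i : ℕ+) : simpleRefl i * simpleRefl i = 1 :=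
  Subtype.ext (Equiv.swap_mul_self i (i + 1))

@[simp] lemma mul_simpleRefl_mul_simpleRefl (w : SInf) (i : ℕ+) :
    w * simpleRefl i * simpleRefl i = w := by
  rw [mul_assoc, simpleRefl_mul_self, mul_one]

@[simp] lemma simpleRefl_mul_simpleRefl_mul (w : SInf) (i : ℕ+) :
    simpleRefl i * (simpleRefl i * w) = w := by
  rw [← mul_assoc, simpleRefl_mul_self, one_mul]

@[simp] lemma simpleRefl_inv (i : ℕ+) : (simpleRefl i)⁻¹ = simpleRefl i :=
  inv_eq_of_mul_eq_one_left (simpleRefl_mul_self i)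

lemma pnat_ne_add_one (i : ℕ+) : i ≠ i + 1 := (PNat.lt_add_right i 1).ne

lemma isDescent_or (w : SInf) (i : ℕ+) : IsDescent w i ∨ w.1 i < w.1 (i + 1) := by
  rcases lt_trichotomy (w.1 (i + 1)) (w.1 i) with h | h | h
  · exact Or.inl h
  · exact absurd (w.1.injective h).symm (pnat_ne_add_one i)
  · exact Or.inr h

lemma not_isDescent_iff (w : SInf) (i : ℕ+) : ¬ IsDescent w i ↔ w.1 i < w.1 (i + 1) := by
  constructor
  · exact (isDescent_or w i).resolve_left
  · exact fun h => h.not_gt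

lemma isDescent_mul_simpleRefl_self (w : SInf) (i : ℕ+) :
    IsDescent (w * simpleRefl i) i ↔ ¬ IsDescent w i := by
  rw [not_isDescent_iff, IsDescent, mul_simpleRefl_apply, mul_simpleRefl_apply,
    Equiv.swap_apply_left, Equiv.swap_apply_right]

/-- The set of inversions of `w`. -/
def inversions (w : SInf) : Set (ℕ+ × ℕ+) := {p | p.1 < p.2 ∧ w.1 p.2 < w.1 p.1}

/-- The number of inversions of `w`. -/
noncomputable def invNum (w : SInf) : ℕ := (inversions w).ncard

/-- `w` fixes every number greater than `n`. -/
def FixesAbove (n : ℕ+) (w : SInf) : Prop := ∀ k, n < k → w.1 k = k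

lemma FixesAbove.mono {m n : ℕ+} (h : m ≤ n) {w : SInf} (hw : FixesAbove m w) :
    FixesAbove n w := fun k hk => hw k (h.trans_lt hk)

lemma FixesAbove.apply_le {n : ℕ+} {w : SInf} (hw : FixesAbove n w) {k : ℕ+} (hk : k ≤ n) :
    w.1 k ≤ n := by
  by_contra h
  have h1 := w.1.injective (hw _ (not_le.1 h))
  exact h (h1.symm ▸ hk)

lemma FixesAbove.mul_simpleRefl {n : ℕ+} {w : SInf} (hw : FixesAbove n w) {i : ℕ+} (hi : i < n) :
    FixesAbove n (w * simpleRefl i) := by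
  intro k hk
  rw [mul_simpleRefl_apply, Equiv.swap_apply_of_ne_of_ne, hw k hk]
  · exact (hi.trans hk).ne'
  · exact ((PNat.add_one_le_iff.2 hi).trans_lt hk).ne'

lemma exists_fixesAbove (w : SInf) : ∃ n, FixesAbove n w := by
  obtain ⟨n, hn⟩ := Set.Finite.bddAbove (show {k | w.1 k ≠ k}.Finite from w.2)
  exact ⟨n, fun k hk => by_contra fun h => (hn h).not_gt hk⟩

lemma FixesAbove.inversions_subset {n : ℕ+} {w : SInf} (hw : FixesAbove n w) :
    inversions w ⊆ Set.Icc (1, 1) (n, n) := by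
  rintro ⟨a, b⟩ ⟨h1, h2⟩
  simp only at h1 h2
  have hb : b ≤ n := by
    by_contra hb
    rw [not_le] at hb
    rw [hw b hb] at h2
    -- Here n < b < w a, so w fixes w a, and injectivity gives w a = a.
    have := w.1.injective (hw _ (hb.trans h2))
    rw [this] at h2
    exact h1.not_gt h2
  exact ⟨⟨one_le, one_le⟩, h1.le.trans hb, hb⟩

lemma inversions_finite (w : SInf) : (inversions w).Finite := by
  obtain ⟨n, hn⟩ := exists_fixesAbove w
  exact (Set.finite_Icc _ _).subset hn.inversions_subset

lemma FixesAbove.invNum_le {n : ℕ+} {w : SInf} (hw : FixesAbove n w) : invNum w ≤ n * n := by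
  have h : inversions w ⊆ ((Finset.Icc 1 n ×ˢ Finset.Icc 1 n : Finset (ℕ+ × ℕ+)) : Set _) := by
    simpa using hw.inversions_subset
  have := Set.ncard_le_ncard h (Finset.finite_toSet _)
  rw [Set.ncard_coe_finset, Finset.card_product, PNat.card_Icc] at this
  simpa [invNum] using this

lemma swap_lt_swap {i a b : ℕ+} (hab : a < b) (h : ¬ (a = i ∧ b = i + 1)) :
    Equiv.swap i (i + 1) a < Equiv.swap i (i + 1) b := by
  simp only [Equiv.swap_apply_def]
  simp only [← PNat.coe_lt_coe, ← PNat.coe_inj] at *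
  split_ifs <;> simp only [PNat.add_coe, PNat.one_coe] at * <;> omega

/-- The swap preserves the order of every pair of positions except (i, i + 1), so old inversions are
carried along and that single pair is new. -/
lemma inversions_mul_simpleRefl {w : SInf} {i : ℕ+} (h : ¬ IsDescent w i) :
    inversions (w * simpleRefl i) = insert (i, i + 1)
      (Prod.map (Equiv.swap i (i + 1)) (Equiv.swap i (i + 1)) '' inversions w) := by
  rw [not_isDescent_iff] at h
  ext ⟨a, b⟩
  simp only [Set.mem_insert_iff, Set.mem_image, Prod.exists, Prod.map_apply, Prod.mk.injEq]
  constructor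
  · rintro ⟨h1, h2⟩
    simp only [mul_simpleRefl_apply] at h1 h2
    by_cases hab : a = i ∧ b = i + 1
    · exact Or.inl hab
    · exact Or.inr ⟨_, _, ⟨swap_lt_swap h1 hab, h2⟩, Equiv.swap_apply_self ..,
        Equiv.swap_apply_self ..⟩
  · rintro (⟨rfl, rfl⟩ | ⟨c, d, ⟨h1, h2⟩, rfl, rfl⟩)
    · refine ⟨PNat.lt_add_right _ 1, ?_⟩
      simpa only [mul_simpleRefl_apply, Equiv.swap_apply_left, Equiv.swap_apply_right] using h
    · refine ⟨swap_lt_swap h1 ?_, ?_⟩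
      · rintro ⟨rfl, rfl⟩
        exact h.not_gt h2
      · simpa only [mul_simpleRefl_apply, Equiv.swap_apply_self] using h2

lemma invNum_mul_simpleRefl {w : SInf} {i : ℕ+} (h : ¬ IsDescent w i) :
    invNum (w * simpleRefl i) = invNum w + 1 := by
  rw [invNum, inversions_mul_simpleRefl h, Set.ncard_insert_of_notMem _
    ((inversions_finite w).image _), Set.ncard_image_of_injective, invNum]
  · exact Prod.map_injective.2 ⟨Equiv.injective _, Equiv.injective _⟩
  · rintro ⟨⟨c, d⟩, ⟨h1, -⟩, h3⟩
    simp only [Prod.map_apply, Prod.mk.injEq] at h1 h3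
    have hc : c = i + 1 := by
      rw [← Equiv.swap_apply_self i (i + 1) c, h3.1, Equiv.swap_apply_left]
    have hd : d = i := by
      rw [← Equiv.swap_apply_self i (i + 1) d, h3.2, Equiv.swap_apply_right]
    rw [hc, hd] at h1
    exact h1.not_gt (PNat.lt_add_right _ 1)

lemma invNum_mul_simpleRefl_of_isDescent {w : SInf} {i : ℕ+} (h : IsDescent w i) :
    invNum (w * simpleRefl i) + 1 = invNum w := by
  have h1 : ¬ IsDescent (w * simpleRefl i) i := by
    rw [isDescent_mul_simpleRefl_self]; exact not_not.2 h
  simpa using (invNum_mul_simpleRefl h1).symm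

/-- Without descents w is increasing, hence an order automorphism of a well-order, and the only one
is the identity. -/
lemma eq_one_of_forall_not_isDescent {w : SInf} (h : ∀ i, ¬ IsDescent w i) : w = 1 := by
  have hlt : ∀ a b : ℕ+, a < b → w.1 a < w.1 b := by
    intro a b
    induction b using PNat.recOn with
    | one => intro hab; exact absurd hab (not_lt_one)
    | succ b ih =>
      intro hab
      have hb := (not_isDescent_iff w b).1 (h b)
      rcases (PNat.lt_add_one_iff.1 hab).lt_or_eq with h1 | rfl
      · exact (ih h1).trans hb
      · exact hb
  have hm : StrictMono w.1 := fun a b => hlt a b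
  let e : ℕ+ ≃o ℕ+ := hm.orderIsoOfSurjective _ w.1.surjective
  have he : e = OrderIso.refl _ := Subsingleton.elim _ _
  apply Subtype.ext
  exact Equiv.ext fun k => congrArg (fun e : ℕ+ ≃o ℕ+ => e k) he

lemma exists_isDescent {w : SInf} (h : w ≠ 1) : ∃ i, IsDescent w i := by
  by_contra! h1
  exact h (eq_one_of_forall_not_isDescent h1)

lemma invNum_prod_le (l : List ℕ+) : invNum (l.map simpleRefl).prod ≤ l.length := by
  induction l using List.reverseRecOn with
  | nil =>
    have : inversions (1 : SInf) = ∅ := by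
      ext ⟨a, b⟩
      simp only [Set.mem_empty_iff_false, iff_false]
      exact fun h => h.1.not_gt h.2
    simp [invNum, this]
  | append_singleton l i ih =>
    simp only [List.map_append, List.map_singleton, List.prod_append, List.prod_singleton,
      List.length_append, List.length_singleton]
    by_cases h : IsDescent (l.map simpleRefl).prod i
    · have := invNum_mul_simpleRefl_of_isDescent h
      omega
    · rw [invNum_mul_simpleRefl h]
      omega

lemma exists_word (n : ℕ) (w : SInf) (h : invNum w = n) :
    ∃ l : List ℕ+, l.length = n ∧ (l.map simpleRefl).prod = w := by
  induction n generalizing w with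
  | zero =>
    refine ⟨[], rfl, ?_⟩
    by_contra h1
    obtain ⟨i, hi⟩ := exists_isDescent (Ne.symm h1)
    have := invNum_mul_simpleRefl_of_isDescent hi
    omega
  | succ n ih =>
    have h1 : w ≠ 1 := by
      rintro rfl
      have := invNum_prod_le []
      simp only [List.map_nil, List.prod_nil, List.length_nil] at this
      omega
    obtain ⟨i, hi⟩ := exists_isDescent h1
    have := invNum_mul_simpleRefl_of_isDescent hi
    obtain ⟨l, hl, hl2⟩ := ih (w * simpleRefl i) (by omega)
    exact ⟨l ++ [i], by simp [hl], by simp [hl2]⟩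

lemma coxLength_eq_invNum (w : SInf) : coxLength w = invNum w := by
  apply le_antisymm
  · exact Nat.sInf_le (exists_word _ w rfl)
  · refine le_csInf ⟨_, exists_word _ w rfl⟩ ?_
    rintro n ⟨l, rfl, rfl⟩
    exact invNum_prod_le l

lemma coxLength_mul_simpleRefl {w : SInf} {i : ℕ+} (h : ¬ IsDescent w i) :
    coxLength (w * simpleRefl i) = coxLength w + 1 := by
  simpa only [coxLength_eq_invNum] using invNum_mul_simpleRefl h

lemma coxLength_mul_simpleRefl_of_isDescent {w : SInf} {i : ℕ+} (h : IsDescent w i) :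
    coxLength (w * simpleRefl i) + 1 = coxLength w := by
  simpa only [coxLength_eq_invNum] using invNum_mul_simpleRefl_of_isDescent h

lemma coxLength_mul_simpleRefl_lt_iff {w : SInf} {i : ℕ+} :
    coxLength (w * simpleRefl i) < coxLength w ↔ IsDescent w i := by
  constructor
  · intro h
    by_contra h1
    rw [coxLength_mul_simpleRefl h1] at h
    omega
  · intro h
    rw [← coxLength_mul_simpleRefl_of_isDescent h]
    omega

/-! ### Left multiplication and Bruhat comparisons -/

lemma coxLength_inv (w : SInf) : coxLength w⁻¹ = coxLength w := by
  have key : ∀ w : SInf, coxLength w⁻¹ ≤ coxLength w := by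
    intro w
    obtain ⟨l, hl, hw⟩ := exists_word _ w rfl
    refine Nat.sInf_le ⟨l.reverse, ?_, ?_⟩
    · rw [List.length_reverse, hl, coxLength_eq_invNum]
    · rw [← hw, List.prod_inv_reverse, List.map_reverse, List.map_map]
      congr 2
  exact le_antisymm (key w) (by simpa using key w⁻¹)

lemma BruhatLT.coxLength_lt {a b : SInf} (h : BruhatLT a b) : coxLength a < coxLength b := by
  induction h with
  | single h => obtain ⟨i, j, -, h⟩ := h; omega
  | tail _ h ih => obtain ⟨i, j, -, h⟩ := h; omega

lemma bruhatLT_mul_simpleRefl_iff {w : SInf} {i : ℕ+} :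
    BruhatLT (w * simpleRefl i) w ↔ IsDescent w i := by
  constructor
  · exact fun h => coxLength_mul_simpleRefl_lt_iff.1 h.coxLength_lt
  · exact fun h => Relation.TransGen.single ⟨i, i + 1, rfl, coxLength_mul_simpleRefl_of_isDescent h⟩

lemma coxLength_simpleRefl_mul (w : SInf) (i : ℕ+) :
    coxLength (simpleRefl i * w) = coxLength (w⁻¹ * simpleRefl i) := by
  rw [← coxLength_inv, mul_inv_rev, simpleRefl_inv]

lemma coxLength_simpleRefl_mul_or (w : SInf) (i : ℕ+) :
    coxLength (simpleRefl i * w) + 1 = coxLength w ∨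
      coxLength (simpleRefl i * w) = coxLength w + 1 := by
  rw [coxLength_simpleRefl_mul, ← coxLength_inv w]
  by_cases h : IsDescent w⁻¹ i
  · exact Or.inl (coxLength_mul_simpleRefl_of_isDescent h)
  · exact Or.inr (coxLength_mul_simpleRefl h)

lemma coxLength_mul_simpleRefl_or (w : SInf) (i : ℕ+) :
    coxLength (w * simpleRefl i) + 1 = coxLength w ∨
      coxLength (w * simpleRefl i) = coxLength w + 1 := by
  by_cases h : IsDescent w i
  · exact Or.inl (coxLength_mul_simpleRefl_of_isDescent h)
  · exact Or.inr (coxLength_mul_simpleRefl h)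

/-- Bruhat covers are defined by right multiplication; conjugating by w brings left multiplication
by s_i into that form. -/
lemma simpleRefl_mul_eq_mul_transp (w : SInf) (i : ℕ+) :
    simpleRefl i * w = w * transp (w.1⁻¹ i) (w.1⁻¹ (i + 1)) := by
  apply Subtype.ext
  change Equiv.swap i (i + 1) * w.1 = w.1 * Equiv.swap _ _
  rw [Equiv.mul_swap_eq_swap_mul]
  simp

lemma bruhatLT_simpleRefl_mul_iff_lt {w : SInf} {i : ℕ+} :
    BruhatLT (simpleRefl i * w) w ↔ coxLength (simpleRefl i * w) < coxLength w := by
  constructor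
  · exact BruhatLT.coxLength_lt
  · intro h
    refine Relation.TransGen.single ⟨_, _, simpleRefl_mul_eq_mul_transp w i, ?_⟩
    rcases coxLength_simpleRefl_mul_or w i with h1 | h1 <;> omega

lemma bruhatLT_simpleRefl_mul_iff {w : SInf} {i : ℕ+} :
    BruhatLT (simpleRefl i * w) w ↔ IsDescent w⁻¹ i := by
  rw [bruhatLT_simpleRefl_mul_iff_lt, coxLength_simpleRefl_mul, ← coxLength_inv w,
    coxLength_mul_simpleRefl_lt_iff]

lemma FixesAbove.not_isDescent {n : ℕ+} {w : SInf} (hw : FixesAbove n w) {i : ℕ+} (hi : n ≤ i) :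
    ¬ IsDescent w i := by
  have h1 : n < i + 1 := PNat.lt_add_one_iff.2 hi
  rw [not_isDescent_iff, hw _ h1]
  rcases hi.lt_or_eq with h | rfl
  · rw [hw _ h]; exact PNat.lt_add_right _ 1
  · exact (hw.apply_le le_rfl).trans_lt h1

lemma finite_leftDescents (w : SInf) : {i : ℕ+ | BruhatLT (simpleRefl i * w) w}.Finite := by
  obtain ⟨n, hn⟩ := exists_fixesAbove w⁻¹
  refine (Set.finite_Iic n).subset fun i hi => ?_
  rw [Set.mem_ofPred_eq, bruhatLT_simpleRefl_mul_iff] at hi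
  by_contra h
  exact hn.not_isDescent (not_le.1 h).le hi

/-- The left descents of `w`. -/
noncomputable def leftDescents (w : SInf) : Finset ℕ+ := (finite_leftDescents w).toFinset

@[simp] lemma mem_leftDescents {w : SInf} {i : ℕ+} :
    i ∈ leftDescents w ↔ BruhatLT (simpleRefl i * w) w := by
  simp [leftDescents]

/-- Adjacent lengths among w, s_k w, w s_i, s_k w s_i differ by one. Both sides say that s_k w s_i
is two shorter than w, which forces s_k w to lie in between. -/
lemma mem_leftDescents_mul_simpleRefl_iff {w : SInf} {i k : ℕ+} (h : IsDescent w i) :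
    k ∈ leftDescents (w * simpleRefl i) ↔
      k ∈ leftDescents w ∧ IsDescent (simpleRefl k * w) i := by
  rw [mem_leftDescents, mem_leftDescents, bruhatLT_simpleRefl_mul_iff_lt,
    bruhatLT_simpleRefl_mul_iff_lt, ← coxLength_mul_simpleRefl_lt_iff, mul_assoc]
  have h1 := coxLength_mul_simpleRefl_of_isDescent h
  have h2 := coxLength_simpleRefl_mul_or w k
  have h3 := coxLength_simpleRefl_mul_or (w * simpleRefl i) k
  have h4 := coxLength_mul_simpleRefl_or (simpleRefl k * w) i
  rw [mul_assoc] at h4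
  omega

/-! ### Divided differences and their nil-Coxeter relations -/

lemma X_sub_X_ne_zero {i j : ℕ+} (h : i ≠ j) :
    (MvPolynomial.X i - MvPolynomial.X j : MvPolynomial ℕ+ ℤ) ≠ 0 :=
  sub_ne_zero.2 fun h1 => h (MvPolynomial.X_injective h1)

lemma dividedDiff_unique {i : ℕ+} {f g : MvPolynomial ℕ+ ℤ}
    (h : (MvPolynomial.X i - MvPolynomial.X (i + 1)) * g =
      f - MvPolynomial.rename (Equiv.swap i (i + 1)) f) : dividedDiff i f = g :=
  mul_left_cancel₀ (X_sub_X_ne_zero (pnat_ne_add_one i)) ((dividedDiff_spec i f).trans h.symm)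

/-- The divided difference as a linear map. -/
noncomputable def dividedDiffHom (i : ℕ+) : MvPolynomial ℕ+ ℤ →ₗ[ℤ] MvPolynomial ℕ+ ℤ :=
  AddMonoidHom.toIntLinearMap
    { toFun := dividedDiff i
      map_zero' := dividedDiff_unique (by simp)
      map_add' := fun f g => dividedDiff_unique (by
        rw [mul_add, dividedDiff_spec, dividedDiff_spec, map_add]; ring) }

@[simp] lemma dividedDiffHom_apply (i : ℕ+) (f : MvPolynomial ℕ+ ℤ) :
    dividedDiffHom i f = dividedDiff i f := rfl

lemma rename_swap_rename_swap (i j : ℕ+) (f : MvPolynomial ℕ+ ℤ) :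
    MvPolynomial.rename (Equiv.swap i j) (MvPolynomial.rename (Equiv.swap i j) f) = f := by
  rw [MvPolynomial.rename_rename]
  have : (Equiv.swap i j : ℕ+ → ℕ+) ∘ Equiv.swap i j = id := by
    ext k; simp
  rw [this, MvPolynomial.rename_id_apply]

lemma rename_swap_dividedDiff (i : ℕ+) (f : MvPolynomial ℕ+ ℤ) :
    MvPolynomial.rename (Equiv.swap i (i + 1)) (dividedDiff i f) = dividedDiff i f := by
  have h := dividedDiff_spec i f
  have h1 := congrArg (MvPolynomial.rename (Equiv.swap i (i + 1))) h
  rw [map_mul, map_sub, map_sub, rename_swap_rename_swap, MvPolynomial.rename_X,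
    MvPolynomial.rename_X, Equiv.swap_apply_left, Equiv.swap_apply_right] at h1
  apply mul_left_cancel₀ (X_sub_X_ne_zero (pnat_ne_add_one i))
  linear_combination -h1 - h

lemma dividedDiff_eq_zero {i : ℕ+} {f : MvPolynomial ℕ+ ℤ}
    (h : MvPolynomial.rename (Equiv.swap i (i + 1)) f = f) : dividedDiff i f = 0 :=
  dividedDiff_unique (by rw [h, mul_zero, sub_self])

lemma rename_swap_eq_of_dividedDiff_eq_zero {i : ℕ+} {f : MvPolynomial ℕ+ ℤ}
    (h : dividedDiff i f = 0) : MvPolynomial.rename (Equiv.swap i (i + 1)) f = f := by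
  have := dividedDiff_spec i f
  rw [h, mul_zero] at this
  exact (sub_eq_zero.1 this.symm).symm

@[simp] lemma dividedDiff_dividedDiff_self (i : ℕ+) (f : MvPolynomial ℕ+ ℤ) :
    dividedDiff i (dividedDiff i f) = 0 :=
  dividedDiff_eq_zero (rename_swap_dividedDiff i f)

lemma dividedDiff_X_mul {i : ℕ+} {g : MvPolynomial ℕ+ ℤ}
    (h : MvPolynomial.rename (Equiv.swap i (i + 1)) g = g) :
    dividedDiff i (MvPolynomial.X i * g) = g :=
  dividedDiff_unique (by
    rw [map_mul, h, MvPolynomial.rename_X, Equiv.swap_apply_left]; ring)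

lemma rename_swap_comm {i j : ℕ+} (h : i + 1 < j) (f : MvPolynomial ℕ+ ℤ) :
    MvPolynomial.rename (Equiv.swap i (i + 1)) (MvPolynomial.rename (Equiv.swap j (j + 1)) f) =
      MvPolynomial.rename (Equiv.swap j (j + 1))
        (MvPolynomial.rename (Equiv.swap i (i + 1)) f) := by
  rw [MvPolynomial.rename_rename, MvPolynomial.rename_rename]
  congr 2
  rw [← Equiv.coe_trans, ← Equiv.coe_trans, ← Equiv.Perm.mul_def, ← Equiv.Perm.mul_def]
  congr 1
  have h1 : i < j := (PNat.lt_add_right i 1).trans h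
  have h2 : j < j + 1 := PNat.lt_add_right j 1
  exact (Equiv.Perm.disjoint_swap_swap (by
    simp [h1.ne, h.ne, h2.ne, (h1.trans h2).ne, (h.trans h2).ne, pnat_ne_add_one])).commute

lemma dividedDiff_comm {i j : ℕ+} (h : i + 1 < j) (f : MvPolynomial ℕ+ ℤ) :
    dividedDiff i (dividedDiff j f) = dividedDiff j (dividedDiff i f) := by
  have h1 : i < j := (PNat.lt_add_right i 1).trans h
  have h2 : j < j + 1 := PNat.lt_add_right j 1
  apply dividedDiff_unique
  apply mul_left_cancel₀ (X_sub_X_ne_zero (pnat_ne_add_one j))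
  have e1 := dividedDiff_spec i f
  have e2 := dividedDiff_spec j f
  have e3 := dividedDiff_spec j (dividedDiff i f)
  have e4 := congrArg (MvPolynomial.rename (Equiv.swap j (j + 1))) e1
  have e5 := congrArg (MvPolynomial.rename (Equiv.swap i (i + 1))) e2
  rw [map_mul, map_sub, map_sub, MvPolynomial.rename_X, MvPolynomial.rename_X,
    Equiv.swap_apply_of_ne_of_ne, Equiv.swap_apply_of_ne_of_ne] at e4 e5
  · rw [rename_swap_comm h] at e5
    linear_combination (MvPolynomial.X i - MvPolynomial.X (i + 1)) * e3 + e1 - e4 - e2 + e5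
  all_goals first
    | exact h1.ne | exact h1.ne' | exact h.ne | exact h.ne'
    | exact (h1.trans h2).ne | exact (h1.trans h2).ne'
    | exact (h.trans h2).ne | exact (h.trans h2).ne'

lemma pnat_ne_add_one_add_one (i : ℕ+) : i ≠ i + 1 + 1 :=
  ((PNat.lt_add_right i 1).trans (PNat.lt_add_right _ 1)).ne

lemma swap_braid (i : ℕ+) :
    Equiv.swap i (i + 1) * Equiv.swap (i + 1) (i + 1 + 1) * Equiv.swap i (i + 1) =
      Equiv.swap (i + 1) (i + 1 + 1) * Equiv.swap i (i + 1) * Equiv.swap (i + 1) (i + 1 + 1) := by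
  have h1 := pnat_ne_add_one i
  have h2 := pnat_ne_add_one (i + 1)
  have h3 := pnat_ne_add_one_add_one i
  rw [Equiv.swap_mul_swap_mul_swap h1 h3, Equiv.swap_comm i (i + 1),
    Equiv.swap_comm (i + 1) (i + 1 + 1), Equiv.swap_mul_swap_mul_swap h2.symm h3.symm,
    Equiv.swap_comm]

lemma rename_swap_braid (i : ℕ+) (f : MvPolynomial ℕ+ ℤ) :
    MvPolynomial.rename (Equiv.swap i (i + 1)) (MvPolynomial.rename (Equiv.swap (i + 1) (i + 1 + 1))
      (MvPolynomial.rename (Equiv.swap i (i + 1)) f)) =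
    MvPolynomial.rename (Equiv.swap (i + 1) (i + 1 + 1)) (MvPolynomial.rename (Equiv.swap i (i + 1))
      (MvPolynomial.rename (Equiv.swap (i + 1) (i + 1 + 1)) f)) := by
  simp only [MvPolynomial.rename_rename, ← Equiv.Perm.coe_mul, ← mul_assoc]
  rw [swap_braid]

section braid

variable (i : ℕ+) (f : MvPolynomial ℕ+ ℤ)

lemma rename_swap_X_sub_X_left :
    MvPolynomial.rename (Equiv.swap i (i + 1))
      (MvPolynomial.X (i + 1) - MvPolynomial.X (i + 1 + 1) : MvPolynomial ℕ+ ℤ) =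
      MvPolynomial.X i - MvPolynomial.X (i + 1 + 1) := by
  rw [map_sub, MvPolynomial.rename_X, MvPolynomial.rename_X, Equiv.swap_apply_right,
    Equiv.swap_apply_of_ne_of_ne (pnat_ne_add_one_add_one i).symm (pnat_ne_add_one _).symm]

lemma rename_swap_X_sub_X_right :
    MvPolynomial.rename (Equiv.swap (i + 1) (i + 1 + 1))
      (MvPolynomial.X i - MvPolynomial.X (i + 1) : MvPolynomial ℕ+ ℤ) =
      MvPolynomial.X i - MvPolynomial.X (i + 1 + 1) := by
  rw [map_sub, MvPolynomial.rename_X, MvPolynomial.rename_X, Equiv.swap_apply_left,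
    Equiv.swap_apply_of_ne_of_ne (pnat_ne_add_one _) (pnat_ne_add_one_add_one i)]

/-- The product of the positive roots of `S_3` acting on positions `i, i + 1, i + 2`. -/
noncomputable def vandermondeThree : MvPolynomial ℕ+ ℤ :=
  (MvPolynomial.X i - MvPolynomial.X (i + 1)) *
    ((MvPolynomial.X (i + 1) - MvPolynomial.X (i + 1 + 1)) *
      (MvPolynomial.X i - MvPolynomial.X (i + 1 + 1)))

lemma vandermondeThree_ne_zero : vandermondeThree i ≠ 0 :=
  mul_ne_zero (X_sub_X_ne_zero (pnat_ne_add_one i)) (mul_ne_zero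
    (X_sub_X_ne_zero (pnat_ne_add_one (i + 1))) (X_sub_X_ne_zero (pnat_ne_add_one_add_one i)))

/-- Clearing denominators turns the triple divided difference into the signed sum of f over the six
permutations of three variables. The other reduced word gives the same sum, whence the braid
relation. -/
lemma vandermondeThree_mul_left :
    vandermondeThree i * dividedDiff i (dividedDiff (i + 1) (dividedDiff i f)) =
      f - MvPolynomial.rename (Equiv.swap i (i + 1)) f
        - MvPolynomial.rename (Equiv.swap (i + 1) (i + 1 + 1)) f
        + MvPolynomial.rename (Equiv.swap (i + 1) (i + 1 + 1))
          (MvPolynomial.rename (Equiv.swap i (i + 1)) f)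
        + MvPolynomial.rename (Equiv.swap i (i + 1))
          (MvPolynomial.rename (Equiv.swap (i + 1) (i + 1 + 1)) f)
        - MvPolynomial.rename (Equiv.swap i (i + 1))
          (MvPolynomial.rename (Equiv.swap (i + 1) (i + 1 + 1))
            (MvPolynomial.rename (Equiv.swap i (i + 1)) f)) := by
  rw [vandermondeThree]
  have e1 := dividedDiff_spec i f
  have e2 := dividedDiff_spec (i + 1) (dividedDiff i f)
  have e3 := dividedDiff_spec i (dividedDiff (i + 1) (dividedDiff i f))
  have e4 := congrArg (MvPolynomial.rename (Equiv.swap i (i + 1))) e2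
  have e5 := congrArg (MvPolynomial.rename (Equiv.swap (i + 1) (i + 1 + 1))) e1
  have e6 := congrArg (MvPolynomial.rename (Equiv.swap i (i + 1))) e5
  rw [map_mul, rename_swap_X_sub_X_left, map_sub, rename_swap_dividedDiff] at e4
  rw [map_mul, rename_swap_X_sub_X_right, map_sub] at e5
  rw [map_mul, map_mul, rename_swap_X_sub_X_right, map_sub, map_sub, MvPolynomial.rename_X,
    MvPolynomial.rename_X, Equiv.swap_apply_left, map_sub,
    Equiv.swap_apply_of_ne_of_ne (pnat_ne_add_one_add_one i).symm (pnat_ne_add_one _).symm] at e6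
  generalize (MvPolynomial.X i : MvPolynomial ℕ+ ℤ) = x at *
  generalize (MvPolynomial.X (i + 1) : MvPolynomial ℕ+ ℤ) = y at *
  generalize (MvPolynomial.X (i + 1 + 1) : MvPolynomial ℕ+ ℤ) = z at *
  linear_combination (y - z) * (x - z) * e3 + (x - z) * e2 - (y - z) * e4 + e1 - e5 + e6

lemma vandermondeThree_mul_right :
    vandermondeThree i * dividedDiff (i + 1) (dividedDiff i (dividedDiff (i + 1) f)) =
      f - MvPolynomial.rename (Equiv.swap (i + 1) (i + 1 + 1)) f
        - MvPolynomial.rename (Equiv.swap i (i + 1)) f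
        + MvPolynomial.rename (Equiv.swap i (i + 1))
          (MvPolynomial.rename (Equiv.swap (i + 1) (i + 1 + 1)) f)
        + MvPolynomial.rename (Equiv.swap (i + 1) (i + 1 + 1))
          (MvPolynomial.rename (Equiv.swap i (i + 1)) f)
        - MvPolynomial.rename (Equiv.swap (i + 1) (i + 1 + 1))
          (MvPolynomial.rename (Equiv.swap i (i + 1))
            (MvPolynomial.rename (Equiv.swap (i + 1) (i + 1 + 1)) f)) := by
  rw [vandermondeThree]
  have e1 := dividedDiff_spec (i + 1) f
  have e2 := dividedDiff_spec i (dividedDiff (i + 1) f)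
  have e3 := dividedDiff_spec (i + 1) (dividedDiff i (dividedDiff (i + 1) f))
  have e4 := congrArg (MvPolynomial.rename (Equiv.swap (i + 1) (i + 1 + 1))) e2
  have e5 := congrArg (MvPolynomial.rename (Equiv.swap i (i + 1))) e1
  have e6 := congrArg (MvPolynomial.rename (Equiv.swap (i + 1) (i + 1 + 1))) e5
  rw [map_mul, rename_swap_X_sub_X_right, map_sub, rename_swap_dividedDiff] at e4
  rw [map_mul, rename_swap_X_sub_X_left, map_sub] at e5
  rw [map_mul, map_mul, rename_swap_X_sub_X_left, map_sub, map_sub, MvPolynomial.rename_X,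
    MvPolynomial.rename_X, Equiv.swap_apply_right, map_sub,
    Equiv.swap_apply_of_ne_of_ne (pnat_ne_add_one _) (pnat_ne_add_one_add_one i)] at e6
  generalize (MvPolynomial.X i : MvPolynomial ℕ+ ℤ) = x at *
  generalize (MvPolynomial.X (i + 1) : MvPolynomial ℕ+ ℤ) = y at *
  generalize (MvPolynomial.X (i + 1 + 1) : MvPolynomial ℕ+ ℤ) = z at *
  linear_combination (x - y) * (x - z) * e3 + (x - z) * e2 - (x - y) * e4 + e1 - e5 + e6

lemma dividedDiff_braid :
    dividedDiff i (dividedDiff (i + 1) (dividedDiff i f)) =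
      dividedDiff (i + 1) (dividedDiff i (dividedDiff (i + 1) f)) := by
  apply mul_left_cancel₀ (vandermondeThree_ne_zero i)
  rw [vandermondeThree_mul_left, vandermondeThree_mul_right, rename_swap_braid]
  ring

end braid

/-- Degrees add in a domain and x_i - x_{i+1} has degree one. This drives the induction for
spanning. -/
lemma totalDegree_dividedDiff_lt {i : ℕ+} {f : MvPolynomial ℕ+ ℤ} (h : dividedDiff i f ≠ 0) :
    (dividedDiff i f).totalDegree + 1 ≤ f.totalDegree := by
  have h0 := X_sub_X_ne_zero (pnat_ne_add_one i)
  have h1 : (MvPolynomial.X i - MvPolynomial.X (i + 1) : MvPolynomial ℕ+ ℤ).totalDegree = 1 :=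
    ((MvPolynomial.isHomogeneous_X ℤ i).sub (MvPolynomial.isHomogeneous_X ℤ (i + 1))).totalDegree h0
  rw [add_comm, ← h1, ← MvPolynomial.totalDegree_mul_of_isDomain h0 h, dividedDiff_spec]
  exact (MvPolynomial.totalDegree_sub _ _).trans
    (max_le le_rfl (MvPolynomial.totalDegree_rename_le _ _))

/-- Such an f is invariant under all adjacent swaps, so its set of variables is closed under i ↦ i +
1; being finite, it is empty. -/
lemma eq_C_of_forall_dividedDiff_eq_zero {f : MvPolynomial ℕ+ ℤ}
    (h : ∀ i, dividedDiff i f = 0) : f = MvPolynomial.C (f.coeff 0) := by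
  rw [← MvPolynomial.vars_eq_empty_iff_eq_C, Finset.eq_empty_iff_forall_notMem]
  intro k hk
  have hs : ∀ i ∈ f.vars, i + 1 ∈ f.vars := by
    intro i hi
    rw [← rename_swap_eq_of_dividedDiff_eq_zero (h i)] at hi
    obtain ⟨j, hj, hji⟩ := Finset.mem_image.1 (MvPolynomial.vars_rename _ _ hi)
    have hj' : j = i + 1 := by
      rw [← Equiv.swap_apply_self i (i + 1) j, hji, Equiv.swap_apply_left]
    exact hj' ▸ hj
  obtain ⟨m, hm, hmax⟩ := f.vars.exists_max_image id ⟨k, hk⟩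
  exact (hmax _ (hs m hm)).not_gt (PNat.lt_add_right m 1)

lemma dividedDiff_eq_zero_of_notMem_vars {i : ℕ+} {f : MvPolynomial ℕ+ ℤ}
    (h : ∀ k ∈ f.vars, k < i) : dividedDiff i f = 0 := by
  apply dividedDiff_eq_zero
  conv_rhs => rw [← MvPolynomial.rename_id_apply f]
  apply MvPolynomial.hom_congr_vars (f₁ := (MvPolynomial.rename (R := ℤ) _).toRingHom)
    (f₂ := (MvPolynomial.rename (R := ℤ) _).toRingHom) _ _ rfl
  · ext; simp
  · intro k hk _
    have := h k hk
    simp [Equiv.swap_apply_of_ne_of_ne this.ne (this.trans (PNat.lt_add_right i 1)).ne]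

/-! ### The derivation ∇, and divided differences of monomials -/

/-- The derivation `∑ ∂/∂x_i`. -/
noncomputable def nabla : Derivation ℤ (MvPolynomial ℕ+ ℤ) (MvPolynomial ℕ+ ℤ) :=
  MvPolynomial.mkDerivation ℤ fun _ => 1

@[simp] lemma nabla_X (i : ℕ+) : nabla (MvPolynomial.X i) = 1 :=
  MvPolynomial.mkDerivation_X _ _ _

lemma nabla_rename (e : ℕ+ → ℕ+) (f : MvPolynomial ℕ+ ℤ) :
    nabla (MvPolynomial.rename e f) = MvPolynomial.rename e (nabla f) := by
  induction f using MvPolynomial.induction_on with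
  | C a => simp [← MvPolynomial.algebraMap_eq]
  | add p q hp hq => simp [hp, hq]
  | mul_X p i hp => simp [hp]

lemma nabla_dividedDiff (i : ℕ+) (f : MvPolynomial ℕ+ ℤ) :
    nabla (dividedDiff i f) = dividedDiff i (nabla f) := by
  symm
  apply dividedDiff_unique
  have := congrArg nabla (dividedDiff_spec i f)
  rw [Derivation.leibniz, map_sub, map_sub, nabla_X, nabla_X, sub_self, smul_zero, add_zero,
    nabla_rename] at this
  exact this

lemma rename_swap_prod {N i : ℕ+} {e : ℕ+ → ℕ} (hi : i < N) (he : e i = e (i + 1)) :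
    MvPolynomial.rename (Equiv.swap i (i + 1))
      (∏ j ∈ Finset.Icc 1 N, MvPolynomial.X j ^ e j : MvPolynomial ℕ+ ℤ) =
      ∏ j ∈ Finset.Icc 1 N, MvPolynomial.X j ^ e j := by
  rw [map_prod]
  have hi1 : i + 1 ≤ N := PNat.add_one_le_iff.2 hi
  have hcases : ∀ j : ℕ+, j ≠ i → j ≠ i + 1 → Equiv.swap i (i + 1) j = j :=
    fun j => Equiv.swap_apply_of_ne_of_ne
  refine Finset.prod_equiv (Equiv.swap i (i + 1)) (fun j => ?_) (fun j _ => ?_)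
  · by_cases h1 : j = i
    · simp [h1, hi.le, hi1]
    by_cases h2 : j = i + 1
    · simp [h2, hi.le, hi1]
    rw [hcases j h1 h2]
  · rw [map_pow, MvPolynomial.rename_X]
    by_cases h1 : j = i
    · simp [h1, he]
    by_cases h2 : j = i + 1
    · simp [h2, he]
    rw [hcases j h1 h2]

lemma prod_eq_X_mul_prod {N i : ℕ+} {e e' : ℕ+ → ℕ} (hi : i ≤ N) (h1 : e i = e' i + 1)
    (h2 : ∀ j ∈ Finset.Icc 1 N, j ≠ i → e j = e' j) :
    (∏ j ∈ Finset.Icc 1 N, MvPolynomial.X j ^ e j : MvPolynomial ℕ+ ℤ) =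
      MvPolynomial.X i * ∏ j ∈ Finset.Icc 1 N, MvPolynomial.X j ^ e' j := by
  have hm : i ∈ Finset.Icc 1 N := by simp [hi]
  rw [← Finset.mul_prod_erase _ _ hm, ← Finset.mul_prod_erase _ _ hm, h1, pow_succ', mul_assoc]
  congr 2
  refine Finset.prod_congr rfl fun j hj => ?_
  rw [h2 j (Finset.mem_of_mem_erase hj) (Finset.ne_of_mem_erase hj)]

/-- The exponents of x_i and x_{i+1} differ by one, so the monomial is x_i times an s_i-invariant.
-/
lemma dividedDiff_prod {N i : ℕ+} {e e' : ℕ+ → ℕ} (hi : i < N) (h1 : e i = e' i + 1)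
    (h2 : ∀ j ∈ Finset.Icc 1 N, j ≠ i → e j = e' j) (h3 : e' i = e' (i + 1)) :
    dividedDiff i (∏ j ∈ Finset.Icc 1 N, MvPolynomial.X j ^ e j : MvPolynomial ℕ+ ℤ) =
      ∏ j ∈ Finset.Icc 1 N, MvPolynomial.X j ^ e' j := by
  rw [prod_eq_X_mul_prod hi.le h1 h2, dividedDiff_X_mul (rename_swap_prod hi h3)]

/-! ### The recursion inside a fixed symmetric group -/

/-- The staircase monomial `x₁^(n-1) x₂^(n-2) ⋯ x_n^0`. -/
noncomputable def staircase (n : ℕ+) : MvPolynomial ℕ+ ℤ :=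
  ∏ k ∈ Finset.Icc 1 n, MvPolynomial.X k ^ ((n : ℕ) - (k : ℕ))

/-- `SchubertChain n w f`: the divided difference recursion inside `S_n` assigns `f` to `w`. -/
inductive SchubertChain (n : ℕ+) : SInf → MvPolynomial ℕ+ ℤ → Prop
  | long : SchubertChain n (longElement n) (staircase n)
  | step (w : SInf) (f : MvPolynomial ℕ+ ℤ) (i : ℕ+) (hf : SchubertChain n w f) (hin : i < n)
      (hi : IsDescent w i) : SchubertChain n (w * simpleRefl i) (dividedDiff i f)

lemma longElement_apply (n k : ℕ+) :
    (longElement n).1 k = if k ≤ n then n + 1 - k else k := rfl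

lemma coe_longElement_apply_of_le {n k : ℕ+} (h : (k : ℕ) ≤ n) :
    ((longElement n).1 k : ℕ) = (n : ℕ) + 1 - k := by
  rw [longElement_apply, if_pos (show k ≤ n from h), PNat.sub_coe,
    if_pos (PNat.lt_add_one_iff.2 h), PNat.add_coe, PNat.one_coe]

lemma fixesAbove_longElement (n : ℕ+) : FixesAbove n (longElement n) := fun k hk => by
  rw [longElement_apply, if_neg hk.not_ge]

lemma coe_longElement_apply_of_lt {n k : ℕ+} (h : (n : ℕ) < k) :
    ((longElement n).1 k : ℕ) = k := by
  rw [fixesAbove_longElement n k h]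

lemma isDescent_longElement {n i : ℕ+} (h : i < n) : IsDescent (longElement n) i := by
  rw [← PNat.coe_lt_coe] at h
  have h1 : ((i + 1 : ℕ+) : ℕ) = i + 1 := rfl
  rw [IsDescent, ← PNat.coe_lt_coe, coe_longElement_apply_of_le h.le,
    coe_longElement_apply_of_le (by omega)]
  omega

lemma sInf_ext {v w : SInf} (h : ∀ k, (v.1 k : ℕ) = w.1 k) : v = w :=
  Subtype.ext (Equiv.ext fun k => PNat.eq (h k))

lemma eq_longElement {n : ℕ+} {w : SInf} (hw : FixesAbove n w) (h : ∀ i < n, IsDescent w i) :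
    w = longElement n := by
  -- As w decreases strictly on 1, …, n, the sum w k + k is weakly decreasing. It is at most n + 1
  -- at k = 1 and at least n + 1 at k = n, so it is constant.
  have hanti : ∀ a b : ℕ+, a ≤ b → b ≤ n → (w.1 b : ℕ) + b ≤ w.1 a + a := by
    intro a b
    induction b using PNat.recOn with
    | one => intro hab _; rw [le_antisymm hab one_le]
    | succ b ih =>
      intro hab hb
      rcases hab.lt_or_eq with h1 | rfl
      · have h2 : (w.1 (b + 1) : ℕ) < w.1 b := h b (PNat.add_one_le_iff.1 hb)
        have h3 := ih (PNat.lt_add_one_iff.1 h1) ((PNat.lt_add_right b 1).le.trans hb)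
        rw [PNat.add_coe, PNat.one_coe]
        omega
      · rfl
  apply sInf_ext
  intro k
  rcases le_or_gt (k : ℕ) n with hk | hk
  · rw [coe_longElement_apply_of_le hk]
    have h1 := hanti 1 k one_le hk
    have h2 := hanti k n hk le_rfl
    have h3 : (w.1 1 : ℕ) ≤ n := hw.apply_le one_le
    have h4 := (w.1 n).pos
    rw [PNat.one_coe] at h1
    omega
  · rw [hw k hk, coe_longElement_apply_of_lt hk]

namespace SchubertChain

variable {n : ℕ+} {w : SInf} {f g : MvPolynomial ℕ+ ℤ}

lemma fixesAbove (h : SchubertChain n w f) : FixesAbove n w := by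
  induction h with
  | long => exact fixesAbove_longElement n
  | step w f i _ hin _ ih => exact ih.mul_simpleRefl hin

lemma eq_or (h : SchubertChain n w f) : (w = longElement n ∧ f = staircase n) ∨
    ∃ i < n, ¬ IsDescent w i ∧ ∃ g, SchubertChain n (w * simpleRefl i) g ∧
      f = dividedDiff i g := by
  cases h with
  | long => exact Or.inl ⟨rfl, rfl⟩
  | step w f i hf hin hi =>
    refine Or.inr ⟨i, hin, ?_, f, by simpa using hf, rfl⟩
    rw [isDescent_mul_simpleRefl_self]
    exact not_not.2 hi

lemma step_of_not_isDescent {i : ℕ+} (h : SchubertChain n (w * simpleRefl i) f) (hin : i < n)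
    (hi : ¬ IsDescent w i) : SchubertChain n w (dividedDiff i f) := by
  have := step _ _ i h hin ((isDescent_mul_simpleRefl_self w i).2 hi)
  simpa using this

end SchubertChain

/-- Climb from w through ascents below n; this stops because inversions are bounded by n², and only
at the long element. -/
lemma exists_schubertChain {n : ℕ+} {w : SInf} (hw : FixesAbove n w) :
    ∃ f, SchubertChain n w f := by
  induction hN : (n * n : ℕ) - invNum w using Nat.strong_induction_on generalizing w with
  | _ N ih =>
    by_cases h : ∀ i < n, IsDescent w i
    · rw [eq_longElement hw h]
      exact ⟨_, SchubertChain.long⟩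
    · push Not at h
      obtain ⟨i, hin, hi⟩ := h
      have h1 := invNum_mul_simpleRefl hi
      have h2 := hw.mul_simpleRefl hin
      have h3 := h2.invNum_le
      obtain ⟨f, hf⟩ := ih _ (by omega) h2 rfl
      exact ⟨_, hf.step_of_not_isDescent hin hi⟩

section descents

variable (w : SInf) {i j : ℕ+}

lemma isDescent_mul_simpleRefl_of_lt (h : i + 1 < j) :
    IsDescent (w * simpleRefl i) j ↔ IsDescent w j := by
  have h1 : i < j := (PNat.lt_add_right i 1).trans h
  have h2 : j < j + 1 := PNat.lt_add_right j 1
  rw [IsDescent, mul_simpleRefl_apply, mul_simpleRefl_apply,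
    Equiv.swap_apply_of_ne_of_ne h1.ne' h.ne',
    Equiv.swap_apply_of_ne_of_ne (h1.trans h2).ne' (h.trans h2).ne', IsDescent]

lemma isDescent_mul_simpleRefl_of_gt (h : i + 1 < j) :
    IsDescent (w * simpleRefl j) i ↔ IsDescent w i := by
  have h1 : i < j := (PNat.lt_add_right i 1).trans h
  have h2 : j < j + 1 := PNat.lt_add_right j 1
  rw [IsDescent, mul_simpleRefl_apply, mul_simpleRefl_apply,
    Equiv.swap_apply_of_ne_of_ne h1.ne (h1.trans h2).ne,
    Equiv.swap_apply_of_ne_of_ne h.ne (h.trans h2).ne, IsDescent]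

lemma isDescent_mul_simpleRefl_succ (i : ℕ+) :
    IsDescent (w * simpleRefl i) (i + 1) ↔ w.1 (i + 1 + 1) < w.1 i := by
  rw [IsDescent, mul_simpleRefl_apply, mul_simpleRefl_apply, Equiv.swap_apply_right,
    Equiv.swap_apply_of_ne_of_ne (pnat_ne_add_one_add_one i).symm (pnat_ne_add_one _).symm]

lemma isDescent_mul_simpleRefl_add_one (i : ℕ+) :
    IsDescent (w * simpleRefl (i + 1)) i ↔ w.1 (i + 1 + 1) < w.1 i := by
  rw [IsDescent, mul_simpleRefl_apply, mul_simpleRefl_apply, Equiv.swap_apply_left,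
    Equiv.swap_apply_of_ne_of_ne (pnat_ne_add_one _) (pnat_ne_add_one_add_one i)]

lemma isDescent_mul_mul_simpleRefl_left (i : ℕ+) :
    IsDescent (w * simpleRefl i * simpleRefl (i + 1)) i ↔ IsDescent w (i + 1) := by
  rw [isDescent_mul_simpleRefl_add_one, mul_simpleRefl_apply, mul_simpleRefl_apply,
    Equiv.swap_apply_left,
    Equiv.swap_apply_of_ne_of_ne (pnat_ne_add_one_add_one i).symm (pnat_ne_add_one _).symm,
    IsDescent]

lemma isDescent_mul_mul_simpleRefl_right (i : ℕ+) :
    IsDescent (w * simpleRefl (i + 1) * simpleRefl i) (i + 1) ↔ IsDescent w i := by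
  rw [isDescent_mul_simpleRefl_succ, mul_simpleRefl_apply, mul_simpleRefl_apply,
    Equiv.swap_apply_right,
    Equiv.swap_apply_of_ne_of_ne (pnat_ne_add_one _) (pnat_ne_add_one_add_one i), IsDescent]

lemma mul_simpleRefl_comm (h : i + 1 < j) :
    w * simpleRefl i * simpleRefl j = w * simpleRefl j * simpleRefl i := by
  have h1 : i < j := (PNat.lt_add_right i 1).trans h
  have h2 : j < j + 1 := PNat.lt_add_right j 1
  rw [mul_assoc, mul_assoc]
  congr 1
  exact Subtype.ext (Equiv.Perm.disjoint_swap_swap (by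
    simp [h1.ne, h.ne, h2.ne, (h1.trans h2).ne, (h.trans h2).ne, pnat_ne_add_one])).commute

lemma mul_simpleRefl_braid (i : ℕ+) :
    w * simpleRefl i * simpleRefl (i + 1) * simpleRefl i =
      w * simpleRefl (i + 1) * simpleRefl i * simpleRefl (i + 1) := by
  have : simpleRefl i * simpleRefl (i + 1) * simpleRefl i =
      simpleRefl (i + 1) * simpleRefl i * simpleRefl (i + 1) := Subtype.ext (swap_braid i)
  simpa only [mul_assoc] using congrArg (w * ·) this

end descents

/-- Take p at a common element above w s_i and w s_j: w s_i s_j if j > i + 1, and w s_i s_j s_i if j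
= i + 1. Uniqueness at greater length writes f and g through p, and the commutation or braid
relation concludes. -/
lemma schubertChain_diamond {n : ℕ+} {w : SInf} {i j : ℕ+} {f g : MvPolynomial ℕ+ ℤ}
    (ih : ∀ v f g, invNum w < invNum v → SchubertChain n v f → SchubertChain n v g → f = g)
    (hij : i < j) (hin : i < n) (hjn : j < n) (hi : ¬ IsDescent w i) (hj : ¬ IsDescent w j)
    (hf : SchubertChain n (w * simpleRefl i) f) (hg : SchubertChain n (w * simpleRefl j) g) :
    dividedDiff i f = dividedDiff j g := by
  have li := invNum_mul_simpleRefl hi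
  have lj := invNum_mul_simpleRefl hj
  rcases (PNat.add_one_le_iff.2 hij).lt_or_eq with h | rfl
  · obtain ⟨p, hp⟩ := exists_schubertChain (hf.fixesAbove.mul_simpleRefl hjn)
    have h1 : f = dividedDiff j p := ih _ _ _ (by omega) hf (hp.step_of_not_isDescent hjn
      (by rwa [isDescent_mul_simpleRefl_of_lt w h]))
    rw [mul_simpleRefl_comm w h] at hp
    have h2 : g = dividedDiff i p := ih _ _ _ (by omega) hg (hp.step_of_not_isDescent hin
      (by rwa [isDescent_mul_simpleRefl_of_gt w h]))
    rw [h1, h2, dividedDiff_comm h]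
  · have h13 : ¬ w.1 (i + 1 + 1) < w.1 i := by
      rw [not_isDescent_iff] at hi hj
      exact (hi.trans hj).not_gt
    obtain ⟨p, hp⟩ := exists_schubertChain
      ((hf.fixesAbove.mul_simpleRefl hjn).mul_simpleRefl hin)
    have h1 : f = dividedDiff (i + 1) (dividedDiff i p) := ih _ _ _ (by omega) hf
      ((hp.step_of_not_isDescent hin (by rwa [isDescent_mul_mul_simpleRefl_left])
        ).step_of_not_isDescent hjn (by rwa [isDescent_mul_simpleRefl_succ]))
    rw [mul_simpleRefl_braid] at hp
    have h2 : g = dividedDiff i (dividedDiff (i + 1) p) := ih _ _ _ (by omega) hg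
      ((hp.step_of_not_isDescent hjn (by rwa [isDescent_mul_mul_simpleRefl_right])
        ).step_of_not_isDescent hin (by rwa [isDescent_mul_simpleRefl_add_one]))
    rw [h1, h2, dividedDiff_braid]

lemma SchubertChain.unique {n : ℕ+} {w : SInf} {f g : MvPolynomial ℕ+ ℤ}
    (hf : SchubertChain n w f) (hg : SchubertChain n w g) : f = g := by
  induction hN : (n * n : ℕ) - invNum w using Nat.strong_induction_on generalizing w f g with
  | _ N ih =>
    rcases hf.eq_or with ⟨hw1, hf1⟩ | ⟨i, hin, hi, f', hf', rfl⟩ <;>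
      rcases hg.eq_or with ⟨hw2, hg1⟩ | ⟨j, hjn, hj, g', hg', rfl⟩
    · rw [hf1, hg1]
    · exact absurd (isDescent_longElement hjn) (hw1 ▸ hj)
    · exact absurd (isDescent_longElement hin) (hw2 ▸ hi)
    · have ih' : ∀ v f g, invNum w < invNum v → SchubertChain n v f → SchubertChain n v g →
          f = g := by
        intro v f g hv h1 h2
        have := h1.fixesAbove.invNum_le
        exact ih _ (by omega) h1 h2 rfl
      rcases lt_trichotomy i j with h | rfl | h
      · exact schubertChain_diamond ih' h hin hjn hi hj hf' hg'
      · rw [ih' _ _ _ (by rw [invNum_mul_simpleRefl hi]; omega) hf' hg']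
      · exact (schubertChain_diamond ih' h hjn hin hj hi hg' hf').symm

/-! ### Stability in n, and uniqueness of Schubert polynomials -/

/-- The monomials met on the way from the staircase of `n + 1` to the staircase of `n`. -/
noncomputable def partialStaircase (n : ℕ+) (k : ℕ) : MvPolynomial ℕ+ ℤ :=
  ∏ j ∈ Finset.Icc 1 (n + 1),
    MvPolynomial.X j ^ (if (j : ℕ) ≤ k then (n : ℕ) - j else (n : ℕ) + 1 - j)

/-- In one-line notation w is n ⋯ 1 with n + 1 inserted after the first k entries. Each step moves n
+ 1 one place to the right and lowers the exponent of x_{k+1} by one, from the long element of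
S_{n+1} at k = 0 to that of S_n at k = n. -/
lemma schubertChain_partialStaircase (n : ℕ+) (k : ℕ) (hk : k ≤ n) (w : SInf)
    (hw : ∀ j : ℕ+, (w.1 j : ℕ) = if (j : ℕ) ≤ k then (n : ℕ) + 1 - j else
      if (j : ℕ) = k + 1 then (n : ℕ) + 1 else if (j : ℕ) ≤ n + 1 then (n : ℕ) + 2 - j else j) :
    SchubertChain (n + 1) w (partialStaircase n k) := by
  induction k generalizing w with
  | zero =>
    have h1 : w = longElement (n + 1) := by
      apply sInf_ext
      intro j
      have := j.pos
      have hn : ((n + 1 : ℕ+) : ℕ) = n + 1 := rfl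
      rw [hw]
      rcases le_or_gt (j : ℕ) (n + 1 : ℕ+) with hj | hj
      · rw [coe_longElement_apply_of_le hj]
        split_ifs <;> omega
      · rw [coe_longElement_apply_of_lt hj]
        split_ifs <;> omega
    have h2 : partialStaircase n 0 = staircase (n + 1) := by
      refine Finset.prod_congr rfl fun j _ => ?_
      have := j.pos
      rw [if_neg (by omega)]
      rfl
    rw [h1, h2]
    exact SchubertChain.long
  | succ k ih =>
    obtain ⟨i, hi⟩ : ∃ i : ℕ+, (i : ℕ) = k + 1 := ⟨k.succPNat, rfl⟩
    have hin : i < n + 1 := by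
      rw [← PNat.coe_lt_coe, PNat.add_coe, PNat.one_coe]; omega
    have hv : ∀ j : ℕ+, ((w * simpleRefl i).1 j : ℕ) =
        if (j : ℕ) ≤ k then (n : ℕ) + 1 - j else
        if (j : ℕ) = k + 1 then (n : ℕ) + 1 else
        if (j : ℕ) ≤ n + 1 then (n : ℕ) + 2 - j else j := by
      intro j
      rw [mul_simpleRefl_apply, hw, Equiv.swap_apply_def]
      simp only [← PNat.coe_inj, PNat.add_coe, PNat.one_coe, hi]
      by_cases h1 : (j : ℕ) = k + 1
      · simp [h1, hi]
      · by_cases h2 : (j : ℕ) = k + 1 + 1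
        · simp [h2, hi]
          omega
        · simp only [h1, h2, if_false]
          split_ifs <;> omega
    have hd : ¬ IsDescent w i := by
      rw [not_isDescent_iff, ← PNat.coe_lt_coe, hw, hw]
      simp only [PNat.add_coe, PNat.one_coe, hi]
      split_ifs <;> omega
    have := (ih (by omega) _ hv).step_of_not_isDescent hin hd
    convert this using 1
    symm
    apply dividedDiff_prod hin
    · simp only [hi]
      split_ifs <;> omega
    · intro j _ hj
      rw [← PNat.coe_inj.ne, hi] at hj
      split_ifs <;> omega
    · simp only [PNat.add_coe, PNat.one_coe, hi]
      split_ifs <;> omega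

lemma partialStaircase_self (n : ℕ+) : partialStaircase n n = staircase n := by
  have hsub : Finset.Icc 1 n ⊆ Finset.Icc 1 (n + 1) :=
    Finset.Icc_subset_Icc_right (PNat.lt_add_right n 1).le
  rw [partialStaircase, staircase, ← Finset.prod_subset hsub]
  · refine Finset.prod_congr rfl fun j hj => ?_
    rw [if_pos (PNat.coe_le_coe _ _ |>.2 (Finset.mem_Icc.1 hj).2)]
  · intro j h1 h2
    rw [Finset.mem_Icc, ← PNat.coe_le_coe, ← PNat.coe_le_coe] at h1 h2
    simp only [PNat.add_coe, PNat.one_coe] at h1 h2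
    rw [if_neg (by omega), show (n : ℕ) + 1 - j = 0 by omega, pow_zero]

lemma SchubertChain.succ {n : ℕ+} {w : SInf} {f : MvPolynomial ℕ+ ℤ}
    (h : SchubertChain n w f) : SchubertChain (n + 1) w f := by
  induction h with
  | long =>
    rw [← partialStaircase_self]
    refine schubertChain_partialStaircase n n le_rfl _ fun j => ?_
    rcases le_or_gt (j : ℕ) n with hj | hj
    · rw [coe_longElement_apply_of_le hj, if_pos hj]
    · rw [coe_longElement_apply_of_lt hj]
      split_ifs <;> omega
  | step w f i _ hin hi ih => exact ih.step w f i (hin.trans (PNat.lt_add_right n 1)) hi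

lemma SchubertChain.mono {m n : ℕ+} (hmn : m ≤ n) {w : SInf} {f : MvPolynomial ℕ+ ℤ}
    (h : SchubertChain m w f) : SchubertChain n w f := by
  induction n using PNat.recOn with
  | one => rwa [le_antisymm hmn one_le] at h
  | succ n ih =>
    rcases hmn.lt_or_eq with h1 | rfl
    · exact (ih (PNat.lt_add_one_iff.1 h1)).succ
    · exact h

lemma IsSchubert.exists_schubertChain {w : SInf} {f : MvPolynomial ℕ+ ℤ} (h : IsSchubert w f) :
    ∃ n, SchubertChain n w f := by
  induction h with
  | long n => exact ⟨n, SchubertChain.long⟩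
  | step w f i _ hi ih =>
    obtain ⟨n, hn⟩ := ih
    -- Enlarging n to n + i makes s_i available in the finite group.
    refine ⟨n + i, SchubertChain.step w f i (hn.mono (PNat.lt_add_right n i).le) ?_
      (bruhatLT_mul_simpleRefl_iff.1 hi)⟩
    exact PNat.lt_add_left i n

lemma SchubertChain.isSchubert {n : ℕ+} {w : SInf} {f : MvPolynomial ℕ+ ℤ}
    (h : SchubertChain n w f) : IsSchubert w f := by
  induction h with
  | long => exact IsSchubert.long n
  | step w f i _ _ hi ih => exact ih.step w f i (bruhatLT_mul_simpleRefl_iff.2 hi)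

theorem existsUnique_isSchubert (w : SInf) : ∃! f : MvPolynomial ℕ+ ℤ, IsSchubert w f := by
  obtain ⟨n, hn⟩ := exists_fixesAbove w
  obtain ⟨f, hf⟩ := exists_schubertChain hn
  refine ⟨f, hf.isSchubert, fun g hg => ?_⟩
  obtain ⟨m, hm⟩ := hg.exists_schubertChain
  exact (hm.mono (PNat.lt_add_right m n).le).unique (hf.mono (PNat.lt_add_left n m).le)

lemma isSchubert_schubert (w : SInf) : IsSchubert w (schubert w) :=
  Classical.epsilon_spec (existsUnique_isSchubert w).exists

lemma IsSchubert.eq_schubert {w : SInf} {f : MvPolynomial ℕ+ ℤ} (h : IsSchubert w f) :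
    f = schubert w :=
  (existsUnique_isSchubert w).unique h (isSchubert_schubert w)

lemma dividedDiff_schubert_of_isDescent {w : SInf} {i : ℕ+} (h : IsDescent w i) :
    dividedDiff i (schubert w) = schubert (w * simpleRefl i) :=
  (IsSchubert.step w _ i (isSchubert_schubert w) (bruhatLT_mul_simpleRefl_iff.2 h)).eq_schubert

/-- At an ascent 𝔖_w is itself N_i 𝔖_{w s_i}, and N_i² = 0. -/
lemma dividedDiff_schubert_of_not_isDescent {w : SInf} {i : ℕ+} (h : ¬ IsDescent w i) :
    dividedDiff i (schubert w) = 0 := by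
  have h1 := dividedDiff_schubert_of_isDescent ((isDescent_mul_simpleRefl_self w i).2 h)
  rw [mul_simpleRefl_mul_simpleRefl] at h1
  rw [← h1, dividedDiff_dividedDiff_self]

lemma schubert_one : schubert 1 = 1 := by
  have h : longElement 1 = 1 := (eq_longElement (w := 1) (fun _ _ => rfl)
    (fun i hi => absurd hi not_lt_one)).symm
  have := (IsSchubert.long 1).eq_schubert
  rw [h] at this
  rw [← this]
  simp

/-! ### Linear independence -/

/-- The action of the `i`-th divided difference on the coefficients of Schubert polynomials. -/
noncomputable def stepCoeff (i : ℕ+) (c : SInf →₀ ℤ) : SInf →₀ ℤ :=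
  (c.filter (IsDescent · i)).mapDomain (· * simpleRefl i)

lemma stepCoeff_apply_mul {i : ℕ+} {v : SInf} (c : SInf →₀ ℤ) (h : IsDescent v i) :
    stepCoeff i c (v * simpleRefl i) = c v := by
  rw [stepCoeff, Finsupp.mapDomain_apply (mul_left_injective (simpleRefl i)),
    Finsupp.filter_apply_pos (IsDescent · i) _ h]

lemma stepCoeff_apply_of_isDescent {i : ℕ+} {v : SInf} (c : SInf →₀ ℤ) (h : IsDescent v i) :
    stepCoeff i c v = 0 := by
  conv_lhs => rw [← mul_simpleRefl_mul_simpleRefl v i]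
  rw [stepCoeff, Finsupp.mapDomain_apply (mul_left_injective (simpleRefl i)),
    Finsupp.filter_apply_neg]
  rw [isDescent_mul_simpleRefl_self]
  exact not_not.2 h

lemma stepCoeff_apply_of_not_isDescent {i : ℕ+} {v : SInf} (c : SInf →₀ ℤ)
    (h : ¬ IsDescent v i) : stepCoeff i c v = c (v * simpleRefl i) := by
  conv_lhs => rw [← mul_simpleRefl_mul_simpleRefl v i]
  exact stepCoeff_apply_mul c ((isDescent_mul_simpleRefl_self v i).2 h)

lemma dividedDiffHom_linearCombination (i : ℕ+) (c : SInf →₀ ℤ) :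
    dividedDiffHom i (Finsupp.linearCombination ℤ schubert c) =
      Finsupp.linearCombination ℤ schubert (stepCoeff i c) := by
  induction c using Finsupp.induction_linear with
  | zero => rw [stepCoeff, Finsupp.filter_zero, Finsupp.mapDomain_zero, map_zero, map_zero]
  | add c d hc hd =>
    rw [map_add, map_add, hc, hd, stepCoeff, stepCoeff, stepCoeff, Finsupp.filter_add,
      Finsupp.mapDomain_add, map_add]
  | single w a =>
    rw [Finsupp.linearCombination_single, map_smul, dividedDiffHom_apply, stepCoeff]
    by_cases h : IsDescent w i
    · rw [Finsupp.filter_single_of_pos (p := (IsDescent · i)) h, Finsupp.mapDomain_single,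
        Finsupp.linearCombination_single, dividedDiff_schubert_of_isDescent h]
    · rw [Finsupp.filter_single_of_neg (p := (IsDescent · i)) h, Finsupp.mapDomain_zero, map_zero,
        dividedDiff_schubert_of_not_isDescent h, smul_zero]

/-- Applying N_i to the relation lowers all lengths, so by induction c vanishes wherever i is a
descent. Only the identity has no descent, and its polynomial is 1. -/
lemma eq_zero_of_linearCombination_eq_zero (N : ℕ) (c : SInf →₀ ℤ)
    (hN : ∀ w, c w ≠ 0 → coxLength w < N)
    (h : Finsupp.linearCombination ℤ schubert c = 0) : c = 0 := by
  induction N generalizing c with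
  | zero =>
    ext w
    by_contra hw
    exact absurd (hN w hw) (Nat.not_lt_zero _)
  | succ N ih =>
    have h1 : ∀ i w, IsDescent w i → c w = 0 := by
      intro i w hw
      have h2 : stepCoeff i c = 0 := by
        apply ih
        · intro v hv
          by_cases hvi : IsDescent v i
          · exact absurd (stepCoeff_apply_of_isDescent c hvi) hv
          · rw [stepCoeff_apply_of_not_isDescent c hvi] at hv
            have := hN _ hv
            rw [coxLength_mul_simpleRefl hvi] at this
            omega
        · rw [← dividedDiffHom_linearCombination, h, map_zero]
      rw [← stepCoeff_apply_mul c hw, h2, Finsupp.zero_apply]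
    have h2 : c = Finsupp.single 1 (c 1) := by
      ext w
      by_cases hw : w = 1
      · rw [hw, Finsupp.single_eq_same]
      · obtain ⟨i, hi⟩ := exists_isDescent hw
        rw [h1 i w hi, Finsupp.single_eq_of_ne hw]
    rw [h2, Finsupp.linearCombination_single, schubert_one] at h
    rw [h2, (smul_eq_zero.1 h).resolve_right one_ne_zero, Finsupp.single_zero]

theorem linearIndependent_schubert : LinearIndependent ℤ schubert := by
  rw [linearIndependent_iff]
  intro c hc
  refine eq_zero_of_linearCombination_eq_zero (c.support.sup coxLength + 1) c (fun w hw => ?_) hc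
  exact Nat.lt_succ_of_le (Finset.le_sup (Finsupp.mem_support_iff.2 hw))

/-! ### Spanning -/

section span

variable {f : MvPolynomial ℕ+ ℤ} {b : ℕ+ → SInf →₀ ℤ}
  (hb : ∀ i, Finsupp.linearCombination ℤ schubert (b i) = dividedDiff i f)
include hb

lemma coeff_dividedDiff_of_isDescent {i : ℕ+} {v : SInf} (h : IsDescent v i) : b i v = 0 := by
  have h1 : stepCoeff i (b i) = 0 := by
    apply linearIndependent_schubert
    rw [← dividedDiffHom_linearCombination, hb, dividedDiffHom_apply,
      dividedDiff_dividedDiff_self, map_zero]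
  rw [← stepCoeff_apply_mul (b i) h, h1, Finsupp.zero_apply]

/-- A coefficient of w in f must reappear as that of w s_i in N_i f, for each descent i. The
readings agree because commutation or braiding equates further divided differences, whose expansions
are unique. -/
lemma coeff_dividedDiff_eq_of_lt {i j : ℕ+} (hij : i < j) {w : SInf} (hi : IsDescent w i)
    (hj : IsDescent w j) : b i (w * simpleRefl i) = b j (w * simpleRefl j) := by
  rcases (PNat.add_one_le_iff.2 hij).lt_or_eq with h | rfl
  · have h1 : stepCoeff j (b i) = stepCoeff i (b j) := by
      apply linearIndependent_schubert
      rw [← dividedDiffHom_linearCombination, ← dividedDiffHom_linearCombination, hb, hb,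
        dividedDiffHom_apply, dividedDiffHom_apply, dividedDiff_comm h]
    rw [← stepCoeff_apply_mul (b i) ((isDescent_mul_simpleRefl_of_lt w h).2 hj),
      ← stepCoeff_apply_mul (b j) ((isDescent_mul_simpleRefl_of_gt w h).2 hi), h1,
      mul_simpleRefl_comm w h]
  · have h1 : stepCoeff i (stepCoeff (i + 1) (b i)) =
        stepCoeff (i + 1) (stepCoeff i (b (i + 1))) := by
      apply linearIndependent_schubert
      rw [← dividedDiffHom_linearCombination, ← dividedDiffHom_linearCombination,
        ← dividedDiffHom_linearCombination, ← dividedDiffHom_linearCombination, hb, hb]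
      exact dividedDiff_braid i f
    have h13 : w.1 (i + 1 + 1) < w.1 i := lt_trans hj hi
    rw [← stepCoeff_apply_mul (b i) ((isDescent_mul_simpleRefl_succ w i).2 h13),
      ← stepCoeff_apply_mul (b (i + 1)) ((isDescent_mul_simpleRefl_add_one w i).2 h13),
      ← stepCoeff_apply_mul (stepCoeff (i + 1) (b i))
        ((isDescent_mul_mul_simpleRefl_left w i).2 hj),
      ← stepCoeff_apply_mul (stepCoeff i (b (i + 1)))
        ((isDescent_mul_mul_simpleRefl_right w i).2 hi), h1, mul_simpleRefl_braid]

lemma coeff_dividedDiff_eq {i j : ℕ+} {w : SInf} (hi : IsDescent w i) (hj : IsDescent w j) :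
    b i (w * simpleRefl i) = b j (w * simpleRefl j) := by
  rcases lt_trichotomy i j with h | rfl | h
  · exact coeff_dividedDiff_eq_of_lt hb h hi hj
  · rfl
  · exact (coeff_dividedDiff_eq_of_lt hb h hj hi).symm

open Classical in
lemma exists_stepCoeff_eq : ∃ a : SInf →₀ ℤ, ∀ i, stepCoeff i a = b i := by
  -- Read the coefficient of w through any descent. The value 0 at the identity is arbitrary, since
  -- every N_i kills constants.
  let a : SInf → ℤ := fun w =>
    if h : ∃ i, IsDescent w i then b h.choose (w * simpleRefl h.choose) else 0
  have ha : ∀ i w, IsDescent w i → a w = b i (w * simpleRefl i) := by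
    intro i w h
    have h1 : ∃ i, IsDescent w i := ⟨i, h⟩
    rw [show a w = b h1.choose (w * simpleRefl h1.choose) from dif_pos h1]
    exact coeff_dividedDiff_eq hb h1.choose_spec h
  -- N_i f = 0 once i exceeds every variable of f, so only finitely many i contribute, each with
  -- finite support.
  have hsupp : a.support.Finite := by
    refine Set.Finite.subset (f.vars.finite_toSet.biUnion fun n _ =>
      (Set.finite_Iic n).biUnion fun i _ =>
        ((b i).support.finite_toSet.image (· * simpleRefl i))) ?_
    intro w hw
    by_cases h : ∃ i, IsDescent w i
    · obtain ⟨i, hi⟩ := h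
      rw [Function.mem_support, ha i w hi] at hw
      have h1 : ∃ n ∈ f.vars, i ≤ n := by
        by_contra! h1
        have h2 : b i = 0 := by
          apply linearIndependent_schubert
          rw [hb, dividedDiff_eq_zero_of_notMem_vars h1, map_zero]
        exact hw (by rw [h2, Finsupp.zero_apply])
      obtain ⟨n, hn, hin⟩ := h1
      simp only [Set.mem_iUnion]
      exact ⟨n, hn, i, hin, w * simpleRefl i, Finsupp.mem_support_iff.2 hw,
        mul_simpleRefl_mul_simpleRefl w i⟩
    · exact absurd (dif_neg h) hw
  refine ⟨Finsupp.ofSupportFinite a hsupp, fun i => ?_⟩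
  ext v
  by_cases h : IsDescent v i
  · rw [stepCoeff_apply_of_isDescent _ h, coeff_dividedDiff_of_isDescent hb h]
  · rw [stepCoeff_apply_of_not_isDescent _ h, Finsupp.ofSupportFinite_coe,
      ha i _ ((isDescent_mul_simpleRefl_self v i).2 h), mul_simpleRefl_mul_simpleRefl]

end span

lemma C_mem_span_schubert (a : ℤ) :
    MvPolynomial.C a ∈ Submodule.span ℤ (Set.range schubert) := by
  have h : (MvPolynomial.C a : MvPolynomial ℕ+ ℤ) = a • schubert 1 := by
    rw [schubert_one, MvPolynomial.smul_eq_C_mul, mul_one]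
  rw [h]
  exact Submodule.smul_mem _ _ (Submodule.subset_span ⟨1, rfl⟩)

/-- Each N_i f has lower degree or vanishes, so it expands by induction. The glued combination has
the same divided differences as f, hence differs from it by a constant. -/
lemma mem_span_schubert (d : ℕ) (f : MvPolynomial ℕ+ ℤ) (hf : f.totalDegree ≤ d) :
    f ∈ Submodule.span ℤ (Set.range schubert) := by
  induction d generalizing f with
  | zero =>
    rw [MvPolynomial.totalDegree_eq_zero_iff_eq_C.1 (Nat.le_zero.1 hf)]
    exact C_mem_span_schubert _
  | succ d ih =>
    have h1 : ∀ i, ∃ b, Finsupp.linearCombination ℤ schubert b = dividedDiff i f := by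
      intro i
      change dividedDiff i f ∈ LinearMap.range (Finsupp.linearCombination ℤ schubert)
      rw [Finsupp.range_linearCombination]
      by_cases h : dividedDiff i f = 0
      · rw [h]
        exact Submodule.zero_mem _
      · exact ih _ (by have := totalDegree_dividedDiff_lt h; omega)
    choose b hb using h1
    obtain ⟨a, ha⟩ := exists_stepCoeff_eq hb
    have h2 : ∀ i, dividedDiff i (f - Finsupp.linearCombination ℤ schubert a) = 0 := by
      intro i
      rw [← dividedDiffHom_apply, map_sub, dividedDiffHom_linearCombination, ha, hb,
        dividedDiffHom_apply, sub_self]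
    rw [← sub_add_cancel f (Finsupp.linearCombination ℤ schubert a),
      eq_C_of_forall_dividedDiff_eq_zero h2]
    refine Submodule.add_mem _ (C_mem_span_schubert _) ?_
    rw [← Finsupp.range_linearCombination]
    exact ⟨a, rfl⟩

theorem span_schubert : Submodule.span ℤ (Set.range schubert) = ⊤ :=
  eq_top_iff.2 fun f _ => mem_span_schubert _ f le_rfl

/-! ### The action of ∇ on Schubert polynomials -/

lemma nabla_prod (s : Finset ℕ+) (e : ℕ+ → ℕ) :
    nabla (∏ j ∈ s, MvPolynomial.X j ^ e j) = ∑ k ∈ s, (e k : ℤ) •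
      (MvPolynomial.X k ^ (e k - 1) * ∏ j ∈ s.erase k, MvPolynomial.X j ^ e j) := by
  induction s using Finset.induction_on with
  | empty => simp
  | insert a s ha ih =>
    rw [Finset.prod_insert ha, Derivation.leibniz, Derivation.leibniz_pow, nabla_X, ih,
      Finset.sum_insert ha, Finset.erase_insert ha, Finset.smul_sum, add_comm]
    congr 1
    · simp only [smul_eq_mul, mul_one, nsmul_eq_mul, zsmul_eq_mul, Int.cast_natCast]
      ring
    · refine Finset.sum_congr rfl fun k hk => ?_
      have hak : a ≠ k := fun h => ha (h ▸ hk)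
      rw [Finset.erase_insert_of_ne hak, Finset.prod_insert fun h => ha (Finset.mem_of_mem_erase h)]
      simp only [smul_eq_mul, zsmul_eq_mul, Int.cast_natCast]
      ring

lemma dividedDiff_staircase {n k : ℕ+} (hk : k < n) : dividedDiff k (staircase n) =
    MvPolynomial.X k ^ ((n : ℕ) - k - 1) *
      ∏ j ∈ (Finset.Icc 1 n).erase k, MvPolynomial.X j ^ ((n : ℕ) - j) := by
  have hk' : (k : ℕ) < n := hk
  have h := dividedDiff_prod (N := n) (i := k) (e := fun j => (n : ℕ) - j)
    (e' := fun j => if j = k then (n : ℕ) - k - 1 else (n : ℕ) - j) hk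
    (by simp only [if_true]; omega) (fun j _ hj => by simp only [if_neg hj])
    (by
      simp only [if_true, if_neg (pnat_ne_add_one k).symm, PNat.add_coe, PNat.one_coe]
      omega)
  rw [staircase, h, ← Finset.mul_prod_erase _ _ (a := k) (by simp [hk.le]), if_pos rfl]
  congr 1
  refine Finset.prod_congr rfl fun j hj => ?_
  rw [if_neg (Finset.ne_of_mem_erase hj)]

lemma schubert_longElement (n : ℕ+) : schubert (longElement n) = staircase n :=
  (IsSchubert.long n).eq_schubert.symm

lemma longElement_inv (n : ℕ+) : (longElement n)⁻¹ = longElement n :=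
  inv_eq_of_mul_eq_one_left (Subtype.ext (Equiv.ext (longElement_involutive n)))

lemma mem_leftDescents_longElement {n k : ℕ+} : k ∈ leftDescents (longElement n) ↔ k < n := by
  rw [mem_leftDescents, bruhatLT_simpleRefl_mul_iff, longElement_inv]
  refine ⟨fun h => ?_, isDescent_longElement⟩
  by_contra h1
  exact (fixesAbove_longElement n).not_isDescent (not_lt.1 h1) h

lemma coe_sub_of_lt {n k : ℕ+} (h : k < n) : ((n - k : ℕ+) : ℕ) = n - k := by
  rw [PNat.sub_coe, if_pos h]

lemma simpleRefl_mul_longElement {n k : ℕ+} (h : k < n) :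
    simpleRefl (n - k) * longElement n = longElement n * simpleRefl k := by
  apply Subtype.ext
  change Equiv.swap (n - k) (n - k + 1) * (longElement n).1 =
    (longElement n).1 * Equiv.swap k (k + 1)
  have h' : (k : ℕ) < n := h
  have h1 : (longElement n).1 k = n - k + 1 := PNat.eq (by
    rw [coe_longElement_apply_of_le h'.le, PNat.add_coe, coe_sub_of_lt h, PNat.one_coe]; omega)
  have h2 : (longElement n).1 (k + 1) = n - k := PNat.eq (by
    rw [coe_longElement_apply_of_le (PNat.add_one_le_iff.2 h), PNat.add_coe, coe_sub_of_lt h,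
      PNat.one_coe]
    omega)
  rw [Equiv.mul_swap_eq_swap_mul, h1, h2, Equiv.swap_comm]

/-- Differentiating in x_k gives n - k times N_k of the staircase, which is the polynomial of w₀ s_k
= s_{n-k} w₀. Reindexing by k ↦ n - k makes the weight equal the index of the left factor. -/
lemma nabla_staircase (n : ℕ+) : nabla (staircase n) =
    ∑ k ∈ leftDescents (longElement n), (k : ℤ) • schubert (simpleRefl k * longElement n) := by
  have hsub : leftDescents (longElement n) ⊆ Finset.Icc 1 n := fun k hk =>
    Finset.mem_Icc.2 ⟨one_le, (mem_leftDescents_longElement.1 hk).le⟩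
  have hmem : ∀ k ∈ leftDescents (longElement n), n - k ∈ leftDescents (longElement n) := by
    intro k hk
    rw [mem_leftDescents_longElement] at hk ⊢
    rw [← PNat.coe_lt_coe, coe_sub_of_lt hk]
    have := k.pos
    have := n.pos
    omega
  have hinv : ∀ k ∈ leftDescents (longElement n), n - (n - k) = k := by
    intro k hk
    have h1 := mem_leftDescents_longElement.1 hk
    have h2 : (k : ℕ) < n := h1
    apply PNat.eq
    rw [coe_sub_of_lt (mem_leftDescents_longElement.1 (hmem k hk)), coe_sub_of_lt h1]
    omega
  rw [staircase, nabla_prod, ← Finset.sum_subset hsub]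
  · refine Finset.sum_nbij' (n - ·) (n - ·) hmem hmem hinv hinv fun k hk => ?_
    have hk := mem_leftDescents_longElement.1 hk
    rw [simpleRefl_mul_longElement hk,
      ← dividedDiff_schubert_of_isDescent (isDescent_longElement hk),
      schubert_longElement, dividedDiff_staircase hk, coe_sub_of_lt hk]
  -- The remaining index has exponent 0 and contributes nothing.
  · intro k hk1 hk2
    rw [mem_leftDescents_longElement, not_lt, ← PNat.coe_le_coe] at hk2
    rw [Nat.sub_eq_zero_of_le hk2, Nat.cast_zero, zero_smul]

/-- In the inductive step N_i kills the terms whose s_k w has no descent at i; the surviving k are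
exactly the left descents of w s_i. -/
lemma IsSchubert.nabla_eq {w : SInf} {f : MvPolynomial ℕ+ ℤ} (h : IsSchubert w f) :
    nabla f = ∑ k ∈ leftDescents w, (k : ℤ) • schubert (simpleRefl k * w) := by
  induction h with
  | long n => exact nabla_staircase n
  | step w f i _ hi ih =>
    rw [bruhatLT_mul_simpleRefl_iff] at hi
    rw [nabla_dividedDiff, ih, ← dividedDiffHom_apply, map_sum]
    have hf : leftDescents (w * simpleRefl i) =
        (leftDescents w).filter fun k => IsDescent (simpleRefl k * w) i := by
      ext k
      rw [mem_leftDescents_mul_simpleRefl_iff hi, Finset.mem_filter]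
    rw [hf, Finset.sum_filter]
    refine Finset.sum_congr rfl fun k _ => ?_
    rw [map_smul, dividedDiffHom_apply]
    split_ifs with h
    · rw [dividedDiff_schubert_of_isDescent h, mul_assoc]
    · rw [dividedDiff_schubert_of_not_isDescent h, smul_zero]

lemma nabla_schubert (w : SInf) :
    nabla (schubert w) = ∑ k ∈ leftDescents w, (k : ℤ) • schubert (simpleRefl k * w) :=
  (isSchubert_schubert w).nabla_eq

/-! ### Structure coefficients and the identity -/

/-- The basis of Schubert polynomials. -/
noncomputable def schubertBasis : Module.Basis SInf ℤ (MvPolynomial ℕ+ ℤ) :=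
  Module.Basis.mk linearIndependent_schubert span_schubert.ge

@[simp] lemma schubertBasis_apply (w : SInf) : schubertBasis w = schubert w :=
  Module.Basis.mk_apply ..

lemma sum_smul_schubert (c : SInf →₀ ℤ) :
    (c.sum fun w a => a • schubert w) = Finsupp.linearCombination ℤ schubertBasis c := by
  simp [Finsupp.linearCombination_apply]

/-- Spanning makes the choice in `schubertCoeff` satisfy its defining equation, and independence
makes it unique. -/
lemma schubertCoeff_eq (u v : SInf) :
    schubertCoeff u v = schubertBasis.repr (schubert u * schubert v) := by
  have h : ∃ c : SInf →₀ ℤ, (c.sum fun w a => a • schubert w) = schubert u * schubert v :=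
    ⟨schubertBasis.repr (schubert u * schubert v), by
      rw [sum_smul_schubert, schubertBasis.linearCombination_repr]⟩
  have h1 : ((schubertCoeff u v).sum fun w a => a • schubert w) = schubert u * schubert v :=
    Classical.epsilon_spec h
  rw [← h1, sum_smul_schubert, schubertBasis.repr_linearCombination]

lemma finite_coeff_simpleRefl_mul (c : SInf →₀ ℤ) (w : SInf) :
    {k : ℕ+ | BruhatLT w (simpleRefl k * w) ∧ c (simpleRefl k * w) ≠ 0}.Finite := by
  refine (c.support.finite_toSet.biUnion fun x _ => (leftDescents x).finite_toSet).subset ?_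
  rintro k ⟨h1, h2⟩
  simp only [Set.mem_iUnion]
  exact ⟨simpleRefl k * w, Finsupp.mem_support_iff.2 h2, by simpa using h1⟩

open Classical in
lemma nabla_schubert_repr (x w : SInf) : schubertBasis.repr (nabla (schubert x)) w =
    ∑ k ∈ leftDescents x, if x = simpleRefl k * w then (k : ℤ) else 0 := by
  rw [nabla_schubert, map_sum, Finsupp.finsetSum_apply]
  refine Finset.sum_congr rfl fun k _ => ?_
  rw [map_smul, ← schubertBasis_apply, schubertBasis.repr_self, Finsupp.smul_apply,
    Finsupp.single_apply, smul_eq_mul, mul_ite, mul_one, mul_zero]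
  congr 1
  rw [eq_iff_iff]
  constructor
  · rintro rfl; simp
  · rintro rfl; simp

-- This is the transpose of the formula for ∇𝔖_x: for each k, only x = s_k w can contribute to the
-- coefficient of w.
open Classical in
lemma repr_nabla (f : MvPolynomial ℕ+ ℤ) (w : SInf) :
    schubertBasis.repr (nabla f) w = ∑ᶠ (k : ℕ+) (_ : BruhatLT w (simpleRefl k * w)),
      (k : ℤ) * schubertBasis.repr f (simpleRefl k * w) := by
  set c := schubertBasis.repr f with hc
  -- A finite index set containing every relevant k, so that the sums over x and k can be exchanged.
  let T : Finset ℕ+ := c.support.biUnion leftDescents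
  have hf : f = ∑ x ∈ c.support, c x • schubert x := by
    conv_lhs => rw [← schubertBasis.linearCombination_repr f, ← hc, ← sum_smul_schubert]
    rfl
  have hR : (∑ᶠ (k : ℕ+) (_ : BruhatLT w (simpleRefl k * w)), (k : ℤ) * c (simpleRefl k * w)) =
      ∑ k ∈ T, if BruhatLT w (simpleRefl k * w) then (k : ℤ) * c (simpleRefl k * w) else 0 := by
    simp only [finsum_eq_if]
    refine finsum_eq_sum_of_support_subset _ fun k hk => ?_
    rw [Function.mem_support, ne_eq, ite_eq_right_iff, Classical.not_imp] at hk
    exact Finset.mem_biUnion.2 ⟨simpleRefl k * w,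
      Finsupp.mem_support_iff.2 (right_ne_zero_of_mul hk.2), by simpa using hk.1⟩
  rw [hR, hf, map_sum, map_sum, Finsupp.finsetSum_apply]
  have hL : ∀ x ∈ c.support, schubertBasis.repr (nabla (c x • schubert x)) w =
      ∑ k ∈ T, if x = simpleRefl k * w then
        (if BruhatLT w (simpleRefl k * w) then (k : ℤ) * c (simpleRefl k * w) else 0) else 0 := by
    intro x hx
    rw [Derivation.map_smul, map_smul, Finsupp.smul_apply, nabla_schubert_repr, smul_eq_mul,
      Finset.mul_sum]
    have hsub : leftDescents x ⊆ T := Finset.subset_biUnion_of_mem leftDescents hx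
    rw [← Finset.sum_subset hsub]
    · refine Finset.sum_congr rfl fun k hk => ?_
      split_ifs with h1 h2
      · rw [← h1, mul_comm]
      · rw [mem_leftDescents, h1, simpleRefl_mul_simpleRefl_mul] at hk
        exact absurd hk h2
      · exact mul_zero _
    · intro k _ hk
      split_ifs with h1 h2
      · rw [mem_leftDescents, h1, simpleRefl_mul_simpleRefl_mul] at hk
        exact absurd h2 hk
      · rfl
      · rfl
  rw [Finset.sum_congr rfl hL, Finset.sum_comm]
  refine Finset.sum_congr rfl fun k _ => ?_
  rw [Finset.sum_ite_eq']
  split_ifs with h1 h2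
  · rfl
  · rfl
  · rw [Finsupp.notMem_support_iff.1 h1, mul_zero]
  · rfl

lemma finsum_leftDescents (u : SInf) (g : ℕ+ → ℤ) :
    ∑ᶠ (i : ℕ+) (_ : BruhatLT (simpleRefl i * u) u), g i = ∑ i ∈ leftDescents u, g i := by
  rw [← finsum_mem_coe_finset]
  simp only [Finset.mem_coe, mem_leftDescents]

theorem theorem1p1 :
    -- the Schubert polynomials are well defined and form a basis of the ring of polynomials
    (∀ w : SInf, ∃! f : MvPolynomial ℕ+ ℤ, IsSchubert w f) ∧
    LinearIndependent ℤ schubert ∧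
    Submodule.span ℤ (Set.range schubert) = ⊤ ∧
    ∀ u v w : SInf,
      -- the three sums are finite
      {i : ℕ+ | BruhatLT (simpleRefl i * u) u}.Finite ∧
      {j : ℕ+ | BruhatLT (simpleRefl j * v) v}.Finite ∧
      {k : ℕ+ | BruhatLT w (simpleRefl k * w) ∧
        schubertCoeff u v (simpleRefl k * w) ≠ 0}.Finite ∧
      (∑ᶠ (i : ℕ+) (_ : BruhatLT (simpleRefl i * u) u),
          (i : ℤ) * schubertCoeff (simpleRefl i * u) v w) +
        (∑ᶠ (j : ℕ+) (_ : BruhatLT (simpleRefl j * v) v),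
          (j : ℤ) * schubertCoeff u (simpleRefl j * v) w) =
        ∑ᶠ (k : ℕ+) (_ : BruhatLT w (simpleRefl k * w)),
          (k : ℤ) * schubertCoeff u v (simpleRefl k * w) := by
  refine ⟨existsUnique_isSchubert, linearIndependent_schubert, span_schubert, fun u v w =>
    ⟨finite_leftDescents u, finite_leftDescents v, finite_coeff_simpleRefl_mul _ w, ?_⟩⟩
  simp only [schubertCoeff_eq]
  -- The right side becomes the coefficient of w in ∇(𝔖_u 𝔖_v). The Leibniz rule lists the term with
  -- ∇𝔖_v first, hence the final `add_comm`.
  rw [← repr_nabla, Derivation.leibniz, finsum_leftDescents, finsum_leftDescents, nabla_schubert,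
    nabla_schubert, Finset.smul_sum, Finset.smul_sum, map_add, map_sum, map_sum,
    Finsupp.add_apply, Finsupp.finsetSum_apply, Finsupp.finsetSum_apply, add_comm]
  congr 1
  · refine Finset.sum_congr rfl fun i _ => ?_
    rw [smul_eq_mul, mul_smul_comm, map_smul, Finsupp.smul_apply, smul_eq_mul]
  · refine Finset.sum_congr rfl fun i _ => ?_
    rw [smul_eq_mul, mul_smul_comm, map_smul, Finsupp.smul_apply, smul_eq_mul,
      mul_comm (schubert v)]
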